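/- Let $d\in\mathbb N$ and $0<p\le 1$. Let $|\cdot|$ be a norm on $\mathbb R^d$, let $\rho:[0,\infty)\to[0,\infty)$ be a continuous concave function with $\rho(0)=0$, and let $\omega(x)=e^{\rho(|x|)}$ for $x\in\mathbb R^d$. Assume that $\omega$ is an admissible weight, i.e. that $\lim_{n\to\infty}\omega(nx)^{1/n}=1$ for all $x\in\mathbb R^d$, and that $\omega$ satisfies the weak growth condition: there are $C>0$ and $0<\delta\le 1$ with $\omega(x)\ge C(1+|x|)^\delta$ for all $x\in\mathbb Z^d$. Let $\mathcal A_{p\omega}$ be the set of all complex matrices $A=(a_{kl})_{k,l\in\mathbb Z^d}$ with $$\|A\|_{p\omega}=\max\Big\{\sup_{k}\sum_{l}|a_{kl}|^p\omega(k-l)^p,\ \sup_{l}\sum_{k}|a_{kl}|^p\omega(k-l)^p\Big\}<\infty ,$$ a unital $*$-algebra over $\mathbb C$ with the product $(AB)_{kl}=\sum_j a_{kj}b_{jl}$ and the involution $(A^*)_{kl}=\overline{a_{lk}}$. Each $A\in\mathcal A_{p\omega}$ defines a bounded operator $T_A$ on $\ell^2(\mathbb Z^d)$ by $(T_Af)_k=\sum_l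 a_{kl}f_l$, and $A\mapsto T_A$ is an injective unital algebra homomorphism into $B(\ell^2(\mathbb Z^d))$. Let $\sigma_{p\omega}(A)$ be the spectrum of $A$ in $\mathcal A_{p\omega}$, let $r_{p\omega}(A)=\sup\{|\lambda|^p:\lambda\in\sigma_{p\omega}(A)\}$, let $\sigma(T_A)$ be the spectrum of $T_A$ in $B(\ell^2(\mathbb Z^d))$, and let $\|A\|_{op}$ be the operator norm of $T_A$. Then: 1. for every $A=A^*\in\mathcal A_{p\omega}$, $r_{p\omega}(A)=\|A\|_{op}^p$ and $\sigma_{p\omega}(A)=\sigma(T_A)$; 2. $\mathcal A_{p\omega}$ is symmetric, i.e. $\sigma_{p\omega}(AA^*)\subset[0,\infty)$ for every $A\in\mathcal A_{p\omega}$; 3. $\mathcal A_{p\omega}$ is inverse-closed in $B(\ell^2(\mathbb Z^d))$: if $A\in\mathcal A_{p\omega}$ and $T_A$ is invertible in $B(\ell^2(\mathbb Z^d))$, then $T_A^{-1}=T_B$ for some $B\in\mathcal A_{p\omega}$. -/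

import Mathlib

open scoped ENNReal Topology

noncomputable section

namespace PBeurling

/-! ### Admissible weights -/

/-- An admissible weight on `ℝ^d`: a norm `|·|` on `ℝ^d` together with a continuous concave function
`ρ : [0,∞) → [0,∞)`, `ρ 0 = 0` (only the values of `rho` on `[0,∞)` matter), such that
`ω(x) = exp (ρ |x|)` satisfies the Gelfand-Raikov-Shilov condition `ω(n x)^(1/n) → 1`. -/
structure AdmissibleWeight (d : ℕ) where
  nrm : Seminorm ℝ (Fin d → ℝ)
  nrm_definite : ∀ x, nrm x = 0 → x = 0
  rho : ℝ → ℝ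
  rho_nonneg : ∀ t, 0 ≤ t → 0 ≤ rho t
  rho_continuousOn : ContinuousOn rho (Set.Ici 0)
  rho_concaveOn : ConcaveOn ℝ (Set.Ici 0) rho
  rho_zero : rho 0 = 0
  grs : ∀ x : Fin d → ℝ,
    Filter.Tendsto (fun n : ℕ => Real.exp (rho (nrm ((n : ℝ) • x))) ^ (1 / (n : ℝ)))
      Filter.atTop (𝓝 1)

variable {d : ℕ}

/-- The inclusion `ℤ^d ⊆ ℝ^d`. -/
def toReal (m : Fin d → ℤ) : Fin d → ℝ := fun i => (m i : ℝ)

/-- The weight function `ω(x) = exp (ρ |x|)` on `ℝ^d`. -/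
def AdmissibleWeight.fn (ω : AdmissibleWeight d) (x : Fin d → ℝ) : ℝ :=
  Real.exp (ω.rho (ω.nrm x))

/-- The restriction of the weight to `ℤ^d`. -/
def AdmissibleWeight.onInt (ω : AdmissibleWeight d) (m : Fin d → ℤ) : ℝ := ω.fn (toReal m)

/-- The weak growth condition `ω(x) ≥ C (1 + |x|)^δ` on `ℤ^d`, for some `C > 0`, `0 < δ ≤ 1`. -/
def AdmissibleWeight.WeakGrowth (ω : AdmissibleWeight d) : Prop :=
  ∃ C δ : ℝ, 0 < C ∧ 0 < δ ∧ δ ≤ 1 ∧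
    ∀ m : Fin d → ℤ, C * (1 + ω.nrm (toReal m)) ^ δ ≤ ω.onInt m

namespace AdmissibleWeight

variable (ω : AdmissibleWeight d)

theorem rho_mono {s t : ℝ} (hs : 0 ≤ s) (hst : s ≤ t) : ω.rho s ≤ ω.rho t := by
  by_contra! h
  have hlt : s < t := lt_of_le_of_ne hst (by rintro rfl; exact lt_irrefl _ h)
  have ht := ω.rho_nonneg t (hs.trans hst)
  set c := ω.rho s - ω.rho t with hc
  have hcpos : 0 < c := by linarith
  set u := t + (t - s) * (ω.rho t / c + 1) with hu
  have hq : 0 ≤ ω.rho t / c := by positivity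
  have htu : t < u := by
    have : 0 < (t - s) * (ω.rho t / c + 1) := mul_pos (by linarith) (by linarith)
    linarith
  have hus : 0 < u - s := by linarith
  have hcv := ω.rho_concaveOn.2 (Set.mem_Ici.2 hs) (Set.mem_Ici.2 (show (0 : ℝ) ≤ u by linarith))
    (show 0 ≤ (u - t) / (u - s) by apply div_nonneg <;> linarith)
    (show 0 ≤ (t - s) / (u - s) by apply div_nonneg <;> linarith) (by field_simp; ring)
  have he : ((u - t) / (u - s)) • s + ((t - s) / (u - s)) • u = t := by
    simp only [smul_eq_mul]; field_simp; ring
  rw [he] at hcv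
  simp only [smul_eq_mul] at hcv
  have hu0 := ω.rho_nonneg u (by linarith)
  have h1 : (u - t) / (u - s) * ω.rho s ≤ ω.rho t := by
    have : 0 ≤ (t - s) / (u - s) * ω.rho u :=
      mul_nonneg (by apply div_nonneg <;> linarith) hu0
    linarith
  rw [div_mul_eq_mul_div, div_le_iff₀ hus] at h1
  have h2 : (u - t) * c = (t - s) * (ω.rho t + c) := by
    rw [hu]; field_simp; ring
  nlinarith [mul_pos (sub_pos.2 hlt) hcpos]

theorem rho_add {s t : ℝ} (hs : 0 ≤ s) (ht : 0 ≤ t) : ω.rho (s + t) ≤ ω.rho s + ω.rho t := by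
  rcases (add_nonneg hs ht).eq_or_lt with h | h
  · rw [← h, ω.rho_zero]
    exact add_nonneg (ω.rho_nonneg s hs) (ω.rho_nonneg t ht)
  · have key : ∀ a b : ℝ, 0 ≤ a → 0 ≤ b → 0 < a + b →
        a / (a + b) * ω.rho (a + b) ≤ ω.rho a := by
      intro a b ha hb hab
      have hcv := ω.rho_concaveOn.2 (Set.mem_Ici.2 hab.le) (Set.mem_Ici.2 (le_refl (0 : ℝ)))
        (show 0 ≤ a / (a + b) by positivity) (show 0 ≤ b / (a + b) by positivity) (by field_simp)
      have he : (a / (a + b)) • (a + b) + (b / (a + b)) • (0 : ℝ) = a := by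
        simp only [smul_eq_mul]; field_simp; ring
      rw [he] at hcv
      simpa [ω.rho_zero] using hcv
    have h1 := key s t hs ht h
    have h2 := key t s ht hs (by linarith)
    rw [add_comm t s] at h2
    have h3 : s / (s + t) * ω.rho (s + t) + t / (s + t) * ω.rho (s + t) = ω.rho (s + t) := by
      field_simp
    linarith

theorem onInt_pos (m : Fin d → ℤ) : 0 < ω.onInt m := Real.exp_pos _

theorem one_le_onInt (m : Fin d → ℤ) : 1 ≤ ω.onInt m :=
  Real.one_le_exp (ω.rho_nonneg _ (apply_nonneg _ _))

theorem onInt_zero : ω.onInt (0 : Fin d → ℤ) = 1 := by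
  have : toReal (0 : Fin d → ℤ) = 0 := by ext i; simp [toReal]
  simp [onInt, fn, this, ω.rho_zero]

theorem onInt_neg (m : Fin d → ℤ) : ω.onInt (-m) = ω.onInt m := by
  have : toReal (-m) = -toReal m := by ext i; simp [toReal]
  simp [onInt, fn, this, map_neg_eq_map]

theorem onInt_add (m n : Fin d → ℤ) : ω.onInt (m + n) ≤ ω.onInt m * ω.onInt n := by
  have : toReal (m + n) = toReal m + toReal n := by ext i; simp [toReal]
  rw [onInt, onInt, onInt, fn, fn, fn, this, ← Real.exp_add]
  refine Real.exp_le_exp.2 ((ω.rho_mono (apply_nonneg _ _) (map_add_le_add _ _ _)).trans ?_)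
  exact ω.rho_add (apply_nonneg _ _) (apply_nonneg _ _)

end AdmissibleWeight

/-! ### The matrices of finite weighted Schur `p`-norm -/

/-- The weighted Schur `p`-norm
`max (sup_k ∑_l |a_kl|^p ω(k-l)^p) (sup_l ∑_k |a_kl|^p ω(k-l)^p)`, with values in `[0,∞]`. -/
def pNorm (p : ℝ) (ω : AdmissibleWeight d) (A : Matrix (Fin d → ℤ) (Fin d → ℤ) ℂ) : ℝ≥0∞ :=
  max (⨆ k, ∑' l, ENNReal.ofReal (‖A k l‖ ^ p * ω.onInt (k - l) ^ p))
    (⨆ l, ∑' k, ENNReal.ofReal (‖A k l‖ ^ p * ω.onInt (k - l) ^ p))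

section aux

variable {p : ℝ} {ω : AdmissibleWeight d} {A B : Matrix (Fin d → ℤ) (Fin d → ℤ) ℂ}

theorem term_eq (hp : 0 < p) (z : ℂ) (m : Fin d → ℤ) :
    ENNReal.ofReal (‖z‖ ^ p * ω.onInt m ^ p) = ‖z‖ₑ ^ p * ENNReal.ofReal (ω.onInt m) ^ p := by
  rw [ENNReal.ofReal_mul (by positivity), ENNReal.ofReal_rpow_of_nonneg (ω.onInt_pos m).le hp.le,
    ← ENNReal.ofReal_rpow_of_nonneg (norm_nonneg z) hp.le, ofReal_norm]

theorem enorm_tsum_le {ι : Type*} (f : ι → ℂ) : ‖∑' i, f i‖ₑ ≤ ∑' i, ‖f i‖ₑ := by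
  by_cases h : Summable f
  · refine le_of_tendsto (h.hasSum.enorm) (Filter.Eventually.of_forall fun s => ?_)
    exact (enorm_sum_le s f).trans (ENNReal.sum_le_tsum s)
  · simp [tsum_eq_zero_of_not_summable h]

theorem rpow_tsum_le {ι : Type*} (f : ι → ℝ≥0∞) (hp : 0 < p) (hp1 : p ≤ 1) :
    (∑' i, f i) ^ p ≤ ∑' i, f i ^ p := by
  have h : ∀ s : Finset ι, (∑ i ∈ s, f i) ^ p ≤ ∑ i ∈ s, f i ^ p := by
    classical
    intro s
    induction s using Finset.induction_on with
    | empty => simp [hp]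
    | insert a s ha ih =>
      rw [Finset.sum_insert ha, Finset.sum_insert ha]
      exact (ENNReal.rpow_add_le_add_rpow _ _ hp.le hp1).trans (by gcongr)
  rw [← ENNReal.le_rpow_inv_iff hp, ENNReal.tsum_eq_iSup_sum]
  refine iSup_le fun s => ?_
  rw [ENNReal.le_rpow_inv_iff hp]
  exact (h s).trans (ENNReal.sum_le_tsum s)

theorem row_le (k : Fin d → ℤ) :
    ∑' l, ENNReal.ofReal (‖A k l‖ ^ p * ω.onInt (k - l) ^ p) ≤ pNorm p ω A :=
  le_max_of_le_left
    (le_iSup (fun k => ∑' l, ENNReal.ofReal (‖A k l‖ ^ p * ω.onInt (k - l) ^ p)) k)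

theorem col_le (l : Fin d → ℤ) :
    ∑' k, ENNReal.ofReal (‖A k l‖ ^ p * ω.onInt (k - l) ^ p) ≤ pNorm p ω A :=
  le_max_of_le_right
    (le_iSup (fun l => ∑' k, ENNReal.ofReal (‖A k l‖ ^ p * ω.onInt (k - l) ^ p)) l)

theorem pNorm_le {c : ℝ≥0∞}
    (h1 : ∀ k, ∑' l, ENNReal.ofReal (‖A k l‖ ^ p * ω.onInt (k - l) ^ p) ≤ c)
    (h2 : ∀ l, ∑' k, ENNReal.ofReal (‖A k l‖ ^ p * ω.onInt (k - l) ^ p) ≤ c) :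
    pNorm p ω A ≤ c :=
  max_le (iSup_le h1) (iSup_le h2)

theorem pNorm_zero (hp : 0 < p) : pNorm p ω (0 : Matrix (Fin d → ℤ) (Fin d → ℤ) ℂ) ≤ 0 := by
  apply pNorm_le <;> intro <;> simp [Real.zero_rpow hp.ne']

theorem pNorm_add (hp : 0 < p) (hp1 : p ≤ 1) : pNorm p ω (A + B) ≤ pNorm p ω A + pNorm p ω B := by
  have key : ∀ k l, ENNReal.ofReal (‖(A + B) k l‖ ^ p * ω.onInt (k - l) ^ p) ≤
      ENNReal.ofReal (‖A k l‖ ^ p * ω.onInt (k - l) ^ p) +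
        ENNReal.ofReal (‖B k l‖ ^ p * ω.onInt (k - l) ^ p) := by
    intro k l
    rw [term_eq hp, term_eq hp, term_eq hp, ← add_mul]
    gcongr
    exact (ENNReal.rpow_le_rpow (enorm_add_le _ _) hp.le).trans
      (ENNReal.rpow_add_le_add_rpow _ _ hp.le hp1)
  apply pNorm_le
  · intro k
    refine (ENNReal.tsum_le_tsum fun l => key k l).trans ?_
    rw [ENNReal.tsum_add]
    exact add_le_add (row_le k) (row_le k)
  · intro l
    refine (ENNReal.tsum_le_tsum fun k => key k l).trans ?_
    rw [ENNReal.tsum_add]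
    exact add_le_add (col_le l) (col_le l)

theorem pNorm_smul (hp : 0 < p) (c : ℂ) : pNorm p ω (c • A) ≤ ‖c‖ₑ ^ p * pNorm p ω A := by
  have key : ∀ k l, ENNReal.ofReal (‖(c • A) k l‖ ^ p * ω.onInt (k - l) ^ p) =
      ‖c‖ₑ ^ p * ENNReal.ofReal (‖A k l‖ ^ p * ω.onInt (k - l) ^ p) := by
    intro k l
    rw [term_eq hp, term_eq hp, Matrix.smul_apply, smul_eq_mul, enorm_mul,
      ENNReal.mul_rpow_of_nonneg _ _ hp.le, mul_assoc]
  apply pNorm_le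
  · intro k
    simp only [key, ENNReal.tsum_mul_left]
    gcongr
    exact row_le k
  · intro l
    simp only [key, ENNReal.tsum_mul_left]
    gcongr
    exact col_le l

theorem pNorm_one (hp : 0 < p) : pNorm p ω (1 : Matrix (Fin d → ℤ) (Fin d → ℤ) ℂ) ≤ 1 := by
  apply pNorm_le
  · intro k
    rw [tsum_eq_single k]
    · simp [ω.onInt_zero]
    · intro l hl
      simp [Matrix.one_apply_ne hl.symm, Real.zero_rpow hp.ne']
  · intro l
    rw [tsum_eq_single l]
    · simp [ω.onInt_zero]
    · intro k hk
      simp [Matrix.one_apply_ne hk, Real.zero_rpow hp.ne']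

theorem pNorm_conjTranspose : pNorm p ω A.conjTranspose ≤ pNorm p ω A := by
  have key : ∀ k l, ENNReal.ofReal (‖A.conjTranspose k l‖ ^ p * ω.onInt (k - l) ^ p) =
      ENNReal.ofReal (‖A l k‖ ^ p * ω.onInt (l - k) ^ p) := by
    intro k l
    rw [Matrix.conjTranspose_apply, norm_star, ← neg_sub l k, ω.onInt_neg]
  apply pNorm_le
  · intro k
    simp only [key]
    exact col_le k
  · intro l
    simp only [key]
    exact row_le l

end aux

/-- The product of two infinite matrices, `(A ⋆ B)_kl = ∑_j a_kj b_jl`. -/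
def matMul (A B : Matrix (Fin d → ℤ) (Fin d → ℤ) ℂ) : Matrix (Fin d → ℤ) (Fin d → ℤ) ℂ :=
  fun k l => ∑' j, A k j * B j l

theorem pNorm_matMul {p : ℝ} (hp : 0 < p) (hp1 : p ≤ 1) (ω : AdmissibleWeight d)
    (A B : Matrix (Fin d → ℤ) (Fin d → ℤ) ℂ) :
    pNorm p ω (matMul A B) ≤ pNorm p ω A * pNorm p ω B := by
  have key : ∀ k l, ENNReal.ofReal (‖matMul A B k l‖ ^ p * ω.onInt (k - l) ^ p) ≤
      ∑' j, ENNReal.ofReal (‖A k j‖ ^ p * ω.onInt (k - j) ^ p) *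
        ENNReal.ofReal (‖B j l‖ ^ p * ω.onInt (j - l) ^ p) := by
    intro k l
    rw [term_eq hp]
    calc ‖matMul A B k l‖ₑ ^ p * ENNReal.ofReal (ω.onInt (k - l)) ^ p
        ≤ (∑' j, ‖A k j * B j l‖ₑ ^ p) * ENNReal.ofReal (ω.onInt (k - l)) ^ p := by
          gcongr
          exact (ENNReal.rpow_le_rpow (enorm_tsum_le _) hp.le).trans (rpow_tsum_le _ hp hp1)
      _ = ∑' j, ‖A k j * B j l‖ₑ ^ p * ENNReal.ofReal (ω.onInt (k - l)) ^ p :=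
          ENNReal.tsum_mul_right.symm
      _ ≤ _ := by
          refine ENNReal.tsum_le_tsum fun j => ?_
          rw [term_eq hp, term_eq hp, enorm_mul, ENNReal.mul_rpow_of_nonneg _ _ hp.le,
            mul_mul_mul_comm, ← ENNReal.mul_rpow_of_nonneg (ENNReal.ofReal _) _ hp.le,
            ← ENNReal.ofReal_mul (ω.onInt_pos _).le]
          gcongr
          have := ω.onInt_add (k - j) (j - l)
          rwa [sub_add_sub_cancel] at this
  apply pNorm_le
  · intro k
    calc _ ≤ ∑' l, ∑' j, ENNReal.ofReal (‖A k j‖ ^ p * ω.onInt (k - j) ^ p) *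
            ENNReal.ofReal (‖B j l‖ ^ p * ω.onInt (j - l) ^ p) :=
          ENNReal.tsum_le_tsum fun l => key k l
      _ = ∑' j, ENNReal.ofReal (‖A k j‖ ^ p * ω.onInt (k - j) ^ p) *
            ∑' l, ENNReal.ofReal (‖B j l‖ ^ p * ω.onInt (j - l) ^ p) := by
          rw [ENNReal.tsum_comm]; simp only [ENNReal.tsum_mul_left]
      _ ≤ ∑' j, ENNReal.ofReal (‖A k j‖ ^ p * ω.onInt (k - j) ^ p) * pNorm p ω B := by
          refine ENNReal.tsum_le_tsum fun j => ?_
          gcongr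
          exact row_le j
      _ ≤ _ := by
          rw [ENNReal.tsum_mul_right]
          gcongr
          exact row_le k
  · intro l
    calc _ ≤ ∑' k, ∑' j, ENNReal.ofReal (‖A k j‖ ^ p * ω.onInt (k - j) ^ p) *
            ENNReal.ofReal (‖B j l‖ ^ p * ω.onInt (j - l) ^ p) :=
          ENNReal.tsum_le_tsum fun k => key k l
      _ = ∑' j, (∑' k, ENNReal.ofReal (‖A k j‖ ^ p * ω.onInt (k - j) ^ p)) *
            ENNReal.ofReal (‖B j l‖ ^ p * ω.onInt (j - l) ^ p) := by
          rw [ENNReal.tsum_comm]; simp only [ENNReal.tsum_mul_right]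
      _ ≤ ∑' j, pNorm p ω A * ENNReal.ofReal (‖B j l‖ ^ p * ω.onInt (j - l) ^ p) := by
          refine ENNReal.tsum_le_tsum fun j => ?_
          gcongr
          exact col_le j
      _ ≤ _ := by
          rw [ENNReal.tsum_mul_left]
          gcongr
          exact col_le l

/-! ### The Schur test -/

section schur

variable {A : Matrix (Fin d → ℤ) (Fin d → ℤ) ℂ}

theorem row_one_le {p : ℝ} (hp : 0 < p) (hp1 : p ≤ 1) (ω : AdmissibleWeight d)
    (k : Fin d → ℤ) : ∑' l, ‖A k l‖ₑ ≤ pNorm p ω A ^ p⁻¹ := by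
  rw [ENNReal.le_rpow_inv_iff hp]
  refine (rpow_tsum_le _ hp hp1).trans ((ENNReal.tsum_le_tsum fun l => ?_).trans (row_le k))
  rw [term_eq hp]
  refine le_mul_of_one_le_right (by positivity) (ENNReal.one_le_rpow ?_ hp)
  exact ENNReal.one_le_ofReal.2 (ω.one_le_onInt _)

theorem col_one_le {p : ℝ} (hp : 0 < p) (hp1 : p ≤ 1) (ω : AdmissibleWeight d)
    (l : Fin d → ℤ) : ∑' k, ‖A k l‖ₑ ≤ pNorm p ω A ^ p⁻¹ := by
  rw [ENNReal.le_rpow_inv_iff hp]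
  refine (rpow_tsum_le _ hp hp1).trans ((ENNReal.tsum_le_tsum fun k => ?_).trans (col_le l))
  rw [term_eq hp]
  refine le_mul_of_one_le_right (by positivity) (ENNReal.one_le_rpow ?_ hp)
  exact ENNReal.one_le_ofReal.2 (ω.one_le_onInt _)

theorem tsum_mul_rpow_two_le {ι : Type*} (w f : ι → ℝ≥0∞) :
    (∑' i, w i * f i) ^ (2 : ℝ) ≤ (∑' i, w i) * ∑' i, w i * f i ^ (2 : ℝ) := by
  rw [← ENNReal.le_rpow_inv_iff (by norm_num : (0 : ℝ) < 2), ENNReal.tsum_eq_iSup_sum]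
  refine iSup_le fun s => ?_
  refine (ENNReal.inner_le_weight_mul_Lp_of_nonneg s (by norm_num : (1 : ℝ) ≤ 2) w f).trans ?_
  rw [ENNReal.mul_rpow_of_nonneg _ _ (by norm_num : (0 : ℝ) ≤ 2⁻¹)]
  have : (1 - 2⁻¹ : ℝ) = 2⁻¹ := by norm_num
  rw [this]
  gcongr <;> exact ENNReal.sum_le_tsum s

theorem schur_bound {M : ℝ≥0∞} (hr : ∀ k, ∑' l, ‖A k l‖ₑ ≤ M) (hc : ∀ l, ∑' k, ‖A k l‖ₑ ≤ M)
    (f : (Fin d → ℤ) → ℂ) :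
    ∑' k, ‖∑' l, A k l * f l‖ₑ ^ (2 : ℝ) ≤ M ^ (2 : ℝ) * ∑' l, ‖f l‖ₑ ^ (2 : ℝ) := by
  calc ∑' k, ‖∑' l, A k l * f l‖ₑ ^ (2 : ℝ)
      ≤ ∑' k, M * ∑' l, ‖A k l‖ₑ * ‖f l‖ₑ ^ (2 : ℝ) := by
        refine ENNReal.tsum_le_tsum fun k => ?_
        calc _ ≤ (∑' l, ‖A k l‖ₑ * ‖f l‖ₑ) ^ (2 : ℝ) := by
              refine ENNReal.rpow_le_rpow ((enorm_tsum_le _).trans ?_) (by norm_num)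
              simp only [enorm_mul, le_refl]
          _ ≤ _ := (tsum_mul_rpow_two_le _ _).trans (by gcongr; exact hr k)
    _ = M * ∑' l, (∑' k, ‖A k l‖ₑ) * ‖f l‖ₑ ^ (2 : ℝ) := by
        rw [ENNReal.tsum_mul_left, ENNReal.tsum_comm]
        simp only [ENNReal.tsum_mul_right]
    _ ≤ M * ∑' l, M * ‖f l‖ₑ ^ (2 : ℝ) := by
        gcongr with l
        exact hc l
    _ = _ := by
        rw [ENNReal.tsum_mul_left, ← mul_assoc, ENNReal.rpow_two, sq]

end schur

/-! ### The algebra of matrices and its action on `ℓ²` -/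

/-- The space `ℓ²(ℤ^d)`. -/
abbrev L2 (d : ℕ) : Type := lp (fun _ : Fin d → ℤ => ℂ) 2

theorem tsum_enorm_eq (f : L2 d) : ∑' l, ‖f l‖ₑ ^ (2 : ℝ) = ENNReal.ofReal (‖f‖ ^ (2 : ℝ)) := by
  have h : Summable fun l => ‖f l‖ ^ (2 : ℝ) := by
    simpa using (lp.memℓp f).summable (by norm_num)
  have h2 : ∀ l, ‖f l‖ₑ ^ (2 : ℝ) = ENNReal.ofReal (‖f l‖ ^ (2 : ℝ)) := fun l => by
    rw [← ENNReal.ofReal_rpow_of_nonneg (norm_nonneg _) (by norm_num), ofReal_norm]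
  have h3 : ‖f‖ ^ (2 : ℝ) = ∑' l, ‖f l‖ ^ (2 : ℝ) := by
    have := lp.norm_rpow_eq_tsum (p := 2) (by norm_num) f
    simpa using this
  rw [h3, ENNReal.ofReal_tsum_of_nonneg (fun l => by positivity) h]
  exact tsum_congr h2

theorem tsum_enorm_lt_top (f : L2 d) : ∑' l, ‖f l‖ₑ ^ (2 : ℝ) < ⊤ := by
  rw [tsum_enorm_eq]
  exact ENNReal.ofReal_lt_top

theorem memLp_of_tsum {f : (Fin d → ℤ) → ℂ} (h : ∑' l, ‖f l‖ₑ ^ (2 : ℝ) < ⊤) :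
    Memℓp f 2 := by
  apply memℓp_gen
  have h2 : ∀ l, ‖f l‖ ^ (2 : ℝ≥0∞).toReal = (‖f l‖ₑ ^ (2 : ℝ)).toReal := fun l => by
    rw [← ENNReal.toReal_rpow, toReal_enorm]; norm_num
  simp only [h2]
  exact ENNReal.summable_toReal h.ne

/-- The `p`-Beurling algebra of matrices as a linear space of infinite matrices. -/
def beurlingSubmodule (p : Set.Ioc (0 : ℝ) 1) (ω : AdmissibleWeight d) :
    Submodule ℂ (Matrix (Fin d → ℤ) (Fin d → ℤ) ℂ) where
  carrier := {A | pNorm p ω A < ⊤}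
  zero_mem' := (pNorm_zero p.2.1).trans_lt ENNReal.zero_lt_top
  add_mem' ha hb := (pNorm_add p.2.1 p.2.2).trans_lt (ENNReal.add_lt_top.2 ⟨ha, hb⟩)
  smul_mem' c _ ha := (pNorm_smul p.2.1 c).trans_lt
    (ENNReal.mul_lt_top (ENNReal.rpow_lt_top_of_nonneg p.2.1.le enorm_ne_top) ha)

/-- The `p`-Beurling algebra: all matrices `A = (a_kl)` indexed by `ℤ^d` with `‖A‖_{pω} < ∞`. -/
def BeurlingAlgebra (p : Set.Ioc (0 : ℝ) 1) (ω : AdmissibleWeight d) : Type :=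
  beurlingSubmodule p ω

namespace BeurlingAlgebra

variable {p : Set.Ioc (0 : ℝ) 1} {ω : AdmissibleWeight d}

instance : AddCommGroup (BeurlingAlgebra p ω) := inferInstanceAs (AddCommGroup (beurlingSubmodule p ω))

instance : Module ℂ (BeurlingAlgebra p ω) := inferInstanceAs (Module ℂ (beurlingSubmodule p ω))

/-- The underlying infinite matrix. -/
def mat (A : BeurlingAlgebra p ω) : Matrix (Fin d → ℤ) (Fin d → ℤ) ℂ := A.1

theorem mat_lt_top (A : BeurlingAlgebra p ω) : pNorm p ω A.mat < ⊤ := A.2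

theorem mat_injective : Function.Injective (mat : BeurlingAlgebra p ω → _) :=
  Subtype.val_injective

/-- The product `(A ⋆ B)_kl = ∑_j a_kj b_jl`. -/
instance : Mul (BeurlingAlgebra p ω) :=
  ⟨fun A B => ⟨matMul A.mat B.mat, (pNorm_matMul p.2.1 p.2.2 ω _ _).trans_lt
    (ENNReal.mul_lt_top A.mat_lt_top B.mat_lt_top)⟩⟩

/-- The unit is the identity matrix. -/
instance : One (BeurlingAlgebra p ω) :=
  ⟨⟨1, (pNorm_one p.2.1).trans_lt ENNReal.one_lt_top⟩⟩

/-- The involution `(A^*)_kl = conj a_lk`. -/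
instance : Star (BeurlingAlgebra p ω) :=
  ⟨fun A => ⟨A.mat.conjTranspose, pNorm_conjTranspose.trans_lt A.mat_lt_top⟩⟩

theorem mat_add (A B : BeurlingAlgebra p ω) : (A + B).mat = A.mat + B.mat := rfl

theorem mat_smul (c : ℂ) (A : BeurlingAlgebra p ω) : (c • A).mat = c • A.mat := rfl

theorem mat_mul (A B : BeurlingAlgebra p ω) : (A * B).mat = matMul A.mat B.mat := rfl

theorem mat_one : (1 : BeurlingAlgebra p ω).mat = 1 := rfl

theorem mat_star (A : BeurlingAlgebra p ω) : (star A).mat = A.mat.conjTranspose := rfl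

theorem row_lt_top (A : BeurlingAlgebra p ω) (k : Fin d → ℤ) : ∑' l, ‖A.mat k l‖ₑ < ⊤ :=
  (row_one_le p.2.1 p.2.2 ω k).trans_lt
    (ENNReal.rpow_lt_top_of_nonneg (inv_nonneg.2 p.2.1.le) A.mat_lt_top.ne)

theorem summable_mul (A : BeurlingAlgebra p ω) (f : L2 d) (k : Fin d → ℤ) :
    Summable fun l => A.mat k l * f l := by
  have h1 : Summable fun l => ‖A.mat k l‖ := by
    simpa [toReal_enorm] using ENNReal.summable_toReal (A.row_lt_top k).ne
  refine Summable.of_norm_bounded (h1.mul_right ‖f‖) fun l => ?_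
  rw [norm_mul]
  gcongr
  exact lp.norm_apply_le_norm (by norm_num) f l

/-- The Schur bound of a matrix in the algebra. -/
def bd (A : BeurlingAlgebra p ω) : ℝ≥0∞ := pNorm p ω A.mat ^ (p : ℝ)⁻¹

theorem bd_lt_top (A : BeurlingAlgebra p ω) : A.bd < ⊤ :=
  ENNReal.rpow_lt_top_of_nonneg (inv_nonneg.2 p.2.1.le) A.mat_lt_top.ne

theorem bound (A : BeurlingAlgebra p ω) (f : L2 d) :
    ∑' k, ‖∑' l, A.mat k l * f l‖ₑ ^ (2 : ℝ) ≤ A.bd ^ (2 : ℝ) * ∑' l, ‖f l‖ₑ ^ (2 : ℝ) :=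
  schur_bound (row_one_le p.2.1 p.2.2 ω) (col_one_le p.2.1 p.2.2 ω) _

/-- The bounded operator `T_A` on `ℓ²(ℤ^d)` given by `(T_A f)_k = ∑_l a_kl f_l`. -/
def op (A : BeurlingAlgebra p ω) : L2 d →L[ℂ] L2 d :=
  LinearMap.mkContinuous
    { toFun := fun f => ⟨fun k => ∑' l, A.mat k l * f l, memLp_of_tsum ((A.bound f).trans_lt
        (ENNReal.mul_lt_top (ENNReal.rpow_lt_top_of_nonneg (by norm_num) A.bd_lt_top.ne)
          (tsum_enorm_lt_top f)))⟩
      map_add' := fun f g => by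
        ext k
        change ∑' l, A.mat k l * (f l + g l) = _
        simp only [mul_add]
        exact (A.summable_mul f k).tsum_add (A.summable_mul g k)
      map_smul' := fun c f => by
        ext k
        change ∑' l, A.mat k l * (c * f l) = c * ∑' l, A.mat k l * f l
        rw [← tsum_mul_left]
        simp only [mul_left_comm] }
    A.bd.toReal
    (fun f => by
      have h := A.bound f
      set g : L2 d := ⟨fun k => ∑' l, A.mat k l * f l, memLp_of_tsum ((A.bound f).trans_lt
        (ENNReal.mul_lt_top (ENNReal.rpow_lt_top_of_nonneg (by norm_num) A.bd_lt_top.ne)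
          (tsum_enorm_lt_top f)))⟩
      change ‖g‖ ≤ _
      have hg : ∑' k, ‖g k‖ₑ ^ (2 : ℝ) ≤ A.bd ^ (2 : ℝ) * ∑' l, ‖f l‖ₑ ^ (2 : ℝ) := h
      rw [tsum_enorm_eq, tsum_enorm_eq, ← ENNReal.ofReal_toReal A.bd_lt_top.ne,
        ENNReal.ofReal_rpow_of_nonneg ENNReal.toReal_nonneg (by norm_num),
        ← ENNReal.ofReal_mul (by positivity),
        ENNReal.ofReal_le_ofReal_iff (by positivity),
        ← Real.mul_rpow ENNReal.toReal_nonneg (norm_nonneg _)] at hg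
      exact (Real.rpow_le_rpow_iff (norm_nonneg _) (by positivity) (by norm_num)).1 hg)

theorem op_apply (A : BeurlingAlgebra p ω) (f : L2 d) (k : Fin d → ℤ) :
    A.op f k = ∑' l, A.mat k l * f l := rfl

theorem single_self (l : Fin d → ℤ) (c : ℂ) : (lp.single 2 l c : L2 d) l = c :=
  lp.single_apply_self (E := fun _ : Fin d → ℤ => ℂ) 2 l c

theorem single_ne {k l : Fin d → ℤ} (c : ℂ) (h : k ≠ l) : (lp.single 2 l c : L2 d) k = 0 :=
  lp.single_apply_ne (E := fun _ : Fin d → ℤ => ℂ) 2 l c h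

theorem op_single (A : BeurlingAlgebra p ω) (c : ℂ) (k l : Fin d → ℤ) :
    A.op (lp.single 2 l c) k = A.mat k l * c := by
  rw [op_apply, tsum_eq_single l]
  · rw [single_self]
  · intro j hj
    rw [single_ne c hj, mul_zero]

theorem op_injective : Function.Injective (op : BeurlingAlgebra p ω → _) := by
  intro A B h
  apply mat_injective
  ext k l
  have := op_single A 1 k l
  rw [h, op_single] at this
  simpa using this.symm

theorem op_ext {S T : L2 d →L[ℂ] L2 d}
    (h : ∀ (l : Fin d → ℤ) (c : ℂ) k, S (lp.single 2 l c) k = T (lp.single 2 l c) k) : S = T := by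
  refine lp.ext_continuousLinearMap (by norm_num) fun l => ?_
  refine ContinuousLinearMap.ext fun c => ?_
  ext k
  exact h l c k

theorem op_mul (A B : BeurlingAlgebra p ω) : (A * B).op = A.op * B.op := by
  refine op_ext fun l c k => ?_
  rw [op_single, mul_apply_eq_comp, op_apply, mat_mul, matMul, ← tsum_mul_right]
  simp only [op_single, mul_assoc]

theorem op_one : (1 : BeurlingAlgebra p ω).op = 1 := by
  refine op_ext fun l c k => ?_
  rw [op_single, mat_one, one_apply_eq_self]
  by_cases h : k = l
  · subst h; simp
  · rw [single_ne c h, Matrix.one_apply_ne h, zero_mul]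

theorem op_add (A B : BeurlingAlgebra p ω) : (A + B).op = A.op + B.op := by
  refine op_ext fun l c k => ?_
  rw [op_single, mat_add, add_apply, lp.coeFn_add, Pi.add_apply, op_single,
    op_single, Matrix.add_apply, add_mul]

theorem op_smul (z : ℂ) (A : BeurlingAlgebra p ω) : (z • A).op = z • A.op := by
  refine op_ext fun l c k => ?_
  rw [op_single, mat_smul, smul_apply, lp.coeFn_smul, Pi.smul_apply, op_single,
    Matrix.smul_apply, smul_eq_mul, smul_eq_mul, mul_assoc]

theorem op_zero : (0 : BeurlingAlgebra p ω).op = 0 := by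
  simpa using op_smul 0 (0 : BeurlingAlgebra p ω)

instance : Ring (BeurlingAlgebra p ω) :=
  { (inferInstance : AddCommGroup (BeurlingAlgebra p ω)),
    (inferInstance : Mul (BeurlingAlgebra p ω)),
    (inferInstance : One (BeurlingAlgebra p ω)) with
    mul_assoc := fun A B C => op_injective (by simp only [op_mul, mul_assoc])
    one_mul := fun A => op_injective (by rw [op_mul, op_one, one_mul])
    mul_one := fun A => op_injective (by rw [op_mul, op_one, mul_one])
    left_distrib := fun A B C => op_injective (by simp only [op_mul, op_add, mul_add])
    right_distrib := fun A B C => op_injective (by simp only [op_mul, op_add, add_mul])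
    zero_mul := fun A => op_injective (by rw [op_mul, op_zero, zero_mul])
    mul_zero := fun A => op_injective (by rw [op_mul, op_zero, mul_zero]) }

instance : Algebra ℂ (BeurlingAlgebra p ω) :=
  Algebra.ofModule
    (fun c A B => op_injective (by simp only [op_mul, op_smul, smul_mul_assoc]))
    (fun c A B => op_injective (by simp only [op_mul, op_smul, mul_smul_comm]))

instance : StarRing (BeurlingAlgebra p ω) where
  star_involutive A := mat_injective (by simp [mat_star])
  star_mul A B := mat_injective (by
    ext k l
    simp only [mat_star, mat_mul, Matrix.conjTranspose_apply, matMul, tsum_star, star_mul']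
    exact tsum_congr fun j => mul_comm _ _)
  star_add A B := mat_injective (by simp [mat_star, mat_add])

/-- The embedding `A ↦ T_A` of the `p`-Beurling algebra into `B(ℓ²(ℤ^d))`. -/
def toOp (p : Set.Ioc (0 : ℝ) 1) (ω : AdmissibleWeight d) :
    BeurlingAlgebra p ω →ₐ[ℂ] (L2 d →L[ℂ] L2 d) :=
  AlgHom.ofLinearMap
    { toFun := op
      map_add' := op_add
      map_smul' := op_smul }
    op_one op_mul

theorem toOp_apply (A : BeurlingAlgebra p ω) (f : L2 d) (k : Fin d → ℤ) :
    toOp p ω A f k = ∑' l, A.mat k l * f l := rfl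

theorem toOp_injective : Function.Injective (toOp p ω) := op_injective

end BeurlingAlgebra

/-! ### Spectral notions -/

/-- The spectral radius `r(a) = sup {|λ|^p : λ ∈ σ(a)}` of an element of a `p`-Banach algebra, with
values in `[0,∞]`. -/
def pSpectralRadius (p : ℝ) {𝒜 : Type*} [Ring 𝒜] [Algebra ℂ 𝒜] (a : 𝒜) : ℝ≥0∞ :=
  ⨆ z ∈ spectrum ℂ a, ‖z‖ₑ ^ p

/-- A `*`-algebra is symmetric if `σ(a a^*) ⊆ [0,∞)` for all `a`. -/
def IsSymmetricAlgebra (𝒜 : Type*) [Ring 𝒜] [Algebra ℂ 𝒜] [Star 𝒜] : Prop :=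
  ∀ a : 𝒜, ∀ z ∈ spectrum ℂ (a * star a), ∃ t : ℝ, 0 ≤ t ∧ z = (t : ℂ)

/-- A subalgebra, given by a unital embedding `φ : 𝒜 → ℬ`, is inverse-closed in `ℬ` if `a ∈ 𝒜` and
`a⁻¹ ∈ ℬ` imply `a⁻¹ ∈ 𝒜`. -/
def IsInverseClosed {𝒜 ℬ : Type*} [Ring 𝒜] [Algebra ℂ 𝒜] [Ring ℬ] [Algebra ℂ ℬ]
    (φ : 𝒜 →ₐ[ℂ] ℬ) : Prop :=
  Function.Injective φ ∧
    ∀ a : 𝒜, ∀ b : ℬ, φ a * b = 1 → b * φ a = 1 → ∃ a' : 𝒜, φ a' = b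

end PBeurling

end

noncomputable section

namespace PBeurling

variable {d : ℕ}

section schurNorm

variable {p : ℝ} {w w' : (Fin d → ℤ) → ℝ≥0∞} {A B : Matrix (Fin d → ℤ) (Fin d → ℤ) ℂ}

/-! ### Schur norms for arbitrary weights -/

/-! Everything rests on one fact, `isUnit_one_sub`: if `T_A` has operator norm less than 1, then `1
- A` is invertible inside the algebra. The operator norm is compared with the weighted Schur norm in
two stages.

From the operator norm to the unweighted Schur norm (`exists_pow_schurNorm_lt_one`): matrix entries
are bounded by the operator norm, so near the diagonal there are few small entries, while far from
it the weight `‖x‖ ^ s` gives decay. For small `s` this weight is subadditive, hence `1 + ε ‖x‖ ^ s`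
is submultiplicative for every `ε > 0`. A Brandenburg-type iteration then produces a power of
unweighted norm below 1.

From the unweighted to the weighted norm (`exists_equivalent_weight`): cutting the slope of `ρ` at a
small `s` changes `ρ` by a bounded amount, since the Gelfand-Raikov-Shilov condition makes `ρ`
sublinear. This yields an equivalent submultiplicative weight for which that power still has norm
below 1, so its Neumann series converges.

If `T_A` is invertible, a positive multiple of `T_A^* T_A` is within distance 1 of the identity, so
`A^* A` is invertible in the algebra. This gives inverse-closedness, hence equality of spectra; the
other claims are then C*-algebra facts about `T_A`. -/

/-- The weighted Schur `p`-norm for an arbitrary weight function on `ℤ^d`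
(the weight is not raised to the power `p`). -/
def schurNorm (p : ℝ) (w : (Fin d → ℤ) → ℝ≥0∞) (A : Matrix (Fin d → ℤ) (Fin d → ℤ) ℂ) : ℝ≥0∞ :=
  max (⨆ k, ∑' l, ‖A k l‖ₑ ^ p * w (k - l)) (⨆ l, ∑' k, ‖A k l‖ₑ ^ p * w (k - l))

theorem schurNorm_row_le (k : Fin d → ℤ) :
    ∑' l, ‖A k l‖ₑ ^ p * w (k - l) ≤ schurNorm p w A :=
  le_max_of_le_left (le_iSup (fun k => ∑' l, ‖A k l‖ₑ ^ p * w (k - l)) k)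

theorem schurNorm_col_le (l : Fin d → ℤ) :
    ∑' k, ‖A k l‖ₑ ^ p * w (k - l) ≤ schurNorm p w A :=
  le_max_of_le_right (le_iSup (fun l => ∑' k, ‖A k l‖ₑ ^ p * w (k - l)) l)

theorem schurNorm_le {c : ℝ≥0∞} (h1 : ∀ k, ∑' l, ‖A k l‖ₑ ^ p * w (k - l) ≤ c)
    (h2 : ∀ l, ∑' k, ‖A k l‖ₑ ^ p * w (k - l) ≤ c) : schurNorm p w A ≤ c :=
  max_le (iSup_le h1) (iSup_le h2)

theorem pNorm_eq_schurNorm (hp : 0 < p) (ω : AdmissibleWeight d)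
    (A : Matrix (Fin d → ℤ) (Fin d → ℤ) ℂ) :
    pNorm p ω A = schurNorm p (fun x => ENNReal.ofReal (ω.onInt x) ^ p) A := by
  simp only [pNorm, schurNorm, term_eq hp]

theorem schurNorm_le_mul {c : ℝ≥0∞} (h : ∀ x, w x ≤ c * w' x) :
    schurNorm p w A ≤ c * schurNorm p w' A := by
  have key : ∀ k l, ‖A k l‖ₑ ^ p * w (k - l) ≤ c * (‖A k l‖ₑ ^ p * w' (k - l)) := fun k l => by
    rw [mul_left_comm]
    gcongr
    exact h _
  apply schurNorm_le
  · intro k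
    refine (ENNReal.tsum_le_tsum fun l => key k l).trans ?_
    rw [ENNReal.tsum_mul_left]
    gcongr
    exact schurNorm_row_le k
  · intro l
    refine (ENNReal.tsum_le_tsum fun k => key k l).trans ?_
    rw [ENNReal.tsum_mul_left]
    gcongr
    exact schurNorm_col_le l

theorem schurNorm_mono (h : ∀ x, w x ≤ w' x) : schurNorm p w A ≤ schurNorm p w' A := by
  simpa using schurNorm_le_mul (p := p) (A := A) (c := 1) (w := w) (w' := w') (by simpa using h)

theorem schurNorm_add_weight_le :
    schurNorm p (fun x => w x + w' x) A ≤ schurNorm p w A + schurNorm p w' A := by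
  apply schurNorm_le
  · intro k
    simp only [mul_add, ENNReal.tsum_add]
    exact add_le_add (schurNorm_row_le k) (schurNorm_row_le k)
  · intro l
    simp only [mul_add, ENNReal.tsum_add]
    exact add_le_add (schurNorm_col_le l) (schurNorm_col_le l)

theorem schurNorm_const_mul_weight (c : ℝ≥0∞) :
    schurNorm p (fun x => c * w x) A = c * schurNorm p w A := by
  simp only [schurNorm, mul_left_comm _ c, ENNReal.tsum_mul_left, ← ENNReal.mul_iSup]
  exact (Monotone.map_max (f := fun x => c * x) fun x y h => mul_le_mul_right h c).symm

theorem schurNorm_one_le (hp : 0 < p) (hw : w 0 ≤ 1) :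
    schurNorm p w (1 : Matrix (Fin d → ℤ) (Fin d → ℤ) ℂ) ≤ 1 := by
  apply schurNorm_le
  · intro k
    rw [tsum_eq_single k]
    · simpa
    · intro l hl
      simp [Matrix.one_apply_ne hl.symm, hp]
  · intro l
    rw [tsum_eq_single l]
    · simpa
    · intro k hk
      simp [Matrix.one_apply_ne hk, hp]

/-- Since `p ≤ 1`, `t ↦ t ^ p` is countably subadditive. No summability is required: an entry whose
series diverges is 0 by convention. This bound takes the place of completeness when the Neumann
series is summed entrywise. -/
theorem schurNorm_tsum_le (hp : 0 < p) (hp1 : p ≤ 1)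
    (F : ℕ → Matrix (Fin d → ℤ) (Fin d → ℤ) ℂ) :
    schurNorm p w (fun k l => ∑' n, F n k l) ≤ ∑' n, schurNorm p w (F n) := by
  have key : ∀ k l, ‖∑' n, F n k l‖ₑ ^ p * w (k - l) ≤ ∑' n, ‖F n k l‖ₑ ^ p * w (k - l) := by
    intro k l
    rw [ENNReal.tsum_mul_right]
    gcongr
    exact (ENNReal.rpow_le_rpow (enorm_tsum_le _) hp.le).trans (rpow_tsum_le _ hp hp1)
  apply schurNorm_le
  · intro k
    refine (ENNReal.tsum_le_tsum fun l => key k l).trans ?_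
    rw [ENNReal.tsum_comm]
    exact ENNReal.tsum_le_tsum fun n => schurNorm_row_le k
  · intro l
    refine (ENNReal.tsum_le_tsum fun k => key k l).trans ?_
    rw [ENNReal.tsum_comm]
    exact ENNReal.tsum_le_tsum fun n => schurNorm_col_le l

theorem schurNorm_matMul_le (hp : 0 < p) (hp1 : p ≤ 1) (hw : ∀ x y, w (x + y) ≤ w x * w y) :
    schurNorm p w (matMul A B) ≤ schurNorm p w A * schurNorm p w B := by
  have key : ∀ k l, ‖matMul A B k l‖ₑ ^ p * w (k - l) ≤
      ∑' j, ‖A k j‖ₑ ^ p * w (k - j) * (‖B j l‖ₑ ^ p * w (j - l)) := by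
    intro k l
    calc ‖matMul A B k l‖ₑ ^ p * w (k - l)
        ≤ (∑' j, ‖A k j * B j l‖ₑ ^ p) * w (k - l) := by
          gcongr
          exact (ENNReal.rpow_le_rpow (enorm_tsum_le _) hp.le).trans (rpow_tsum_le _ hp hp1)
      _ = ∑' j, ‖A k j * B j l‖ₑ ^ p * w (k - l) := ENNReal.tsum_mul_right.symm
      _ ≤ _ := by
          refine ENNReal.tsum_le_tsum fun j => ?_
          rw [enorm_mul, ENNReal.mul_rpow_of_nonneg _ _ hp.le, mul_mul_mul_comm]
          gcongr
          simpa using hw (k - j) (j - l)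
  apply schurNorm_le
  · intro k
    calc _ ≤ ∑' l, ∑' j, ‖A k j‖ₑ ^ p * w (k - j) * (‖B j l‖ₑ ^ p * w (j - l)) :=
          ENNReal.tsum_le_tsum fun l => key k l
      _ = ∑' j, ‖A k j‖ₑ ^ p * w (k - j) * ∑' l, ‖B j l‖ₑ ^ p * w (j - l) := by
          rw [ENNReal.tsum_comm]; simp only [ENNReal.tsum_mul_left]
      _ ≤ ∑' j, ‖A k j‖ₑ ^ p * w (k - j) * schurNorm p w B := by
          refine ENNReal.tsum_le_tsum fun j => ?_
          gcongr
          exact schurNorm_row_le j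
      _ ≤ _ := by
          rw [ENNReal.tsum_mul_right]
          gcongr
          exact schurNorm_row_le k
  · intro l
    calc _ ≤ ∑' k, ∑' j, ‖A k j‖ₑ ^ p * w (k - j) * (‖B j l‖ₑ ^ p * w (j - l)) :=
          ENNReal.tsum_le_tsum fun k => key k l
      _ = ∑' j, (∑' k, ‖A k j‖ₑ ^ p * w (k - j)) * (‖B j l‖ₑ ^ p * w (j - l)) := by
          rw [ENNReal.tsum_comm]; simp only [ENNReal.tsum_mul_right]
      _ ≤ ∑' j, schurNorm p w A * (‖B j l‖ₑ ^ p * w (j - l)) := by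
          refine ENNReal.tsum_le_tsum fun j => ?_
          gcongr
          exact schurNorm_col_le j
      _ ≤ _ := by
          rw [ENNReal.tsum_mul_left]
          gcongr
          exact schurNorm_col_le l

/-- If all entries of `A` are bounded by `M`, splitting `A` into the band `‖k - l‖ ≤ R` and the
rest bounds its unweighted norm. -/
theorem schurNorm_band_le {M : ℝ≥0∞} (hM : ∀ k l, ‖A k l‖ₑ ≤ M) (hp : 0 < p) {s : ℝ} (hs : 0 < s)
    (R : ℕ) (hR : 0 < R) :
    schurNorm p (fun _ => 1) A ≤
      (2 * R + 1 : ℝ≥0∞) ^ d * M ^ p + ((R : ℝ≥0∞) ^ s)⁻¹ * schurNorm p (fun x => ‖x‖ₑ ^ s) A := by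
  classical
  set box : Finset (Fin d → ℤ) := Finset.Icc (fun _ => -(R : ℤ)) (fun _ => (R : ℤ)) with hbox
  have hcard : (box.card : ℝ≥0∞) = (2 * R + 1) ^ d := by
    have : box.card = (2 * R + 1) ^ d := by
      rw [hbox, Pi.card_Icc]
      simp only [Int.card_Icc, Finset.prod_const, Finset.card_univ, Fintype.card_fin]
      congr 1
      omega
    rw [this]; push_cast; ring
  have hout : ∀ x ∉ box, 1 ≤ ((R : ℝ≥0∞) ^ s)⁻¹ * ‖x‖ₑ ^ s := by
    intro x hx
    have h1 : (R : ℝ≥0∞) ≤ ‖x‖ₑ := by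
      by_contra! hlt
      apply hx
      have h2 : ‖x‖ < R := by
        rw [← ofReal_norm, ← ENNReal.ofReal_natCast,
          ENNReal.ofReal_lt_ofReal_iff (by exact_mod_cast hR)] at hlt
        exact hlt
      rw [hbox, Finset.mem_Icc, Pi.le_def, Pi.le_def, ← forall_and]
      intro i
      have h3 := (norm_le_pi_norm x i).trans_lt h2
      rw [Int.norm_eq_abs] at h3
      have h4 : |x i| < R := by exact_mod_cast h3
      exact ⟨(abs_lt.1 h4).1.le, (abs_lt.1 h4).2.le⟩
    rw [mul_comm, ← div_eq_mul_inv, ENNReal.le_div_iff_mul_le]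
    · rw [one_mul]
      exact ENNReal.rpow_le_rpow h1 hs.le
    · left
      simp [hs, hR.ne']
    · left
      exact (ENNReal.rpow_lt_top_of_nonneg hs.le (ENNReal.natCast_ne_top R)).ne
  have key : ∀ k l, ‖A k l‖ₑ ^ p * 1 ≤ (if k - l ∈ box then M ^ p else 0) +
      ((R : ℝ≥0∞) ^ s)⁻¹ * (‖A k l‖ₑ ^ p * ‖k - l‖ₑ ^ s) := by
    intro k l
    split_ifs with h
    · rw [mul_one]
      exact (ENNReal.rpow_le_rpow (hM k l) hp.le).trans le_self_add
    · rw [zero_add, mul_left_comm]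
      gcongr
      exact hout _ h
  have hsum : ∑' x, (if x ∈ box then M ^ p else 0) = (2 * R + 1 : ℝ≥0∞) ^ d * M ^ p := by
    rw [tsum_eq_sum (s := box) (fun x hx => by simp [hx]), ← hcard]
    simp
  apply schurNorm_le
  · intro k
    refine (ENNReal.tsum_le_tsum fun l => key k l).trans ?_
    rw [ENNReal.tsum_add, ENNReal.tsum_mul_left, ← hsum]
    refine add_le_add ?_ (mul_le_mul_right (schurNorm_row_le k) _)
    exact ((Equiv.subLeft k).tsum_eq (fun x => if x ∈ box then M ^ p else 0)).le
  · intro l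
    refine (ENNReal.tsum_le_tsum fun k => key k l).trans ?_
    rw [ENNReal.tsum_add, ENNReal.tsum_mul_left, ← hsum]
    refine add_le_add ?_ (mul_le_mul_right (schurNorm_col_le l) _)
    exact ((Equiv.subRight l).tsum_eq (fun x => if x ∈ box then M ^ p else 0)).le

end schurNorm

/-! ### The abstract iteration behind the spectral radius comparison. -/

/-- A Brandenburg-type iteration: `a` is a submultiplicative norm of powers, `b` the norm for a
larger weight, and `a` is controlled by a small multiple of `b` up to a geometric error. -/
theorem exists_lt_one_of_interpolation {a b : ℕ → ℝ} {K μ : ℝ} (hK : 0 ≤ K) (hb : ∀ n, 0 ≤ b n)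
    (ha : ∀ n, 0 ≤ a n) (hμ : 1 < μ)
    (h1 : ∀ ε, 0 < ε → ∀ m n, ε * b (m * n) ≤ (a m + ε * b m) ^ n)
    (h2 : ∀ n, a n ≤ K * (1 / 4) ^ n + ((μ ^ 3) ^ n)⁻¹ * b n) :
    ∃ m, 0 < m ∧ a m < 1 := by
  set M := a 1 + 1 with hM
  have hμ0 : 0 < μ := by linarith
  -- Each round divides the geometric rate by `μ`, until it reaches the floor `1/2`; both bounds end
  -- up below 1.
  have step : ∀ j : ℕ, ∃ m, 0 < m ∧ a m ≤ (max (1 / 2) (M / μ ^ j)) ^ m := by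
    intro j
    induction j with
    | zero =>
      refine ⟨1, one_pos, ?_⟩
      rw [pow_one, pow_zero, div_one]
      exact le_max_of_le_right (by linarith)
    | succ j ih =>
      obtain ⟨m, hm, ham⟩ := ih
      set β := max (1 / 2) (M / μ ^ j) with hβ
      have hβ0 : 0 < β := lt_max_of_lt_left (by norm_num)
      set β' := max (1 / 2) (M / μ ^ (j + 1)) with hβ'
      have hββ' : β / μ ≤ β' := by
        rw [hβ, ← max_div_div_right hμ0.le, div_div (M), ← pow_succ]
        exact max_le_max (div_le_self (by norm_num) hμ.le) le_rfl
      have hlt : a m < (β * μ) ^ m :=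
        ham.trans_lt (pow_lt_pow_left₀ (lt_mul_of_one_lt_right hβ0 hμ) hβ0.le hm.ne')
      -- The strict slack between `a m` and `(β * μ) ^ m` leaves room for a small multiple of `b m`,
      -- so `h1` makes `b` grow at rate at most `β * μ` along multiples of `m`.
      obtain ⟨ε, hε, hεm⟩ : ∃ ε, 0 < ε ∧ a m + ε * b m ≤ (β * μ) ^ m := by
        refine ⟨((β * μ) ^ m - a m) / (b m + 1), div_pos (by linarith) (by linarith [hb m]), ?_⟩
        have : ((β * μ) ^ m - a m) / (b m + 1) * b m ≤ (β * μ) ^ m - a m := by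
          rw [div_mul_eq_mul_div, div_le_iff₀ (by linarith [hb m])]
          nlinarith [hb m]
        linarith
      have hbn : ∀ n, b (m * n) ≤ ε⁻¹ * (β * μ) ^ (m * n) := by
        intro n
        have h := (h1 ε hε m n).trans (pow_le_pow_left₀ (add_nonneg (ha m)
          (mul_nonneg hε.le (hb m))) hεm n)
        rw [← pow_mul] at h
        rw [inv_mul_eq_div, le_div_iff₀ hε]
        linarith
      have han : ∀ n, a (m * n) ≤ (K * (1 / 2) ^ (m * n) + ε⁻¹ * (1 / μ) ^ (m * n)) *
          β' ^ (m * n) := by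
        intro n
        have e1 : (1 / 4 : ℝ) ^ (m * n) ≤ (1 / 2) ^ (m * n) * β' ^ (m * n) := by
          rw [← mul_pow]
          refine pow_le_pow_left₀ (by norm_num) ?_ _
          have : (1 / 2 : ℝ) ≤ β' := le_max_left _ _
          linarith
        have e2 : ((μ ^ 3) ^ (m * n))⁻¹ * (β * μ) ^ (m * n) ≤
            (1 / μ) ^ (m * n) * β' ^ (m * n) := by
          -- Of the three factors `μ⁻¹`, one cancels the loss in `β * μ`, one improves the rate to
          -- `β / μ`, and the last is left to absorb the constant `ε⁻¹` for large `n`.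
          rw [← inv_pow, ← mul_pow, ← mul_pow]
          refine pow_le_pow_left₀ (by positivity) ?_ _
          calc (μ ^ 3)⁻¹ * (β * μ) = 1 / μ * (β / μ) := by field_simp
            _ ≤ 1 / μ * β' := by gcongr
        calc a (m * n) ≤ K * (1 / 4) ^ (m * n) + ((μ ^ 3) ^ (m * n))⁻¹ * b (m * n) := h2 _
          _ ≤ K * ((1 / 2) ^ (m * n) * β' ^ (m * n)) +
              ((μ ^ 3) ^ (m * n))⁻¹ * (ε⁻¹ * (β * μ) ^ (m * n)) := by
            gcongr
            exact hbn n
          _ = K * ((1 / 2) ^ (m * n) * β' ^ (m * n)) +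
              ε⁻¹ * (((μ ^ 3) ^ (m * n))⁻¹ * (β * μ) ^ (m * n)) := by ring
          _ ≤ K * ((1 / 2) ^ (m * n) * β' ^ (m * n)) +
              ε⁻¹ * ((1 / μ) ^ (m * n) * β' ^ (m * n)) := by gcongr
          _ = _ := by ring
      have hmn : Filter.Tendsto (fun n => m * n) Filter.atTop Filter.atTop :=
        Filter.tendsto_id.const_mul_atTop' hm
      have hlim : Filter.Tendsto (fun n => K * (1 / 2) ^ (m * n) + ε⁻¹ * (1 / μ) ^ (m * n))
          Filter.atTop (𝓝 (K * 0 + ε⁻¹ * 0)) :=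
        (((tendsto_pow_atTop_nhds_zero_of_lt_one (by norm_num) (by norm_num)).comp
          hmn).const_mul K).add (((tendsto_pow_atTop_nhds_zero_of_lt_one (by positivity)
          ((div_lt_one hμ0).2 hμ)).comp hmn).const_mul ε⁻¹)
      rw [mul_zero, mul_zero, add_zero] at hlim
      obtain ⟨n, hn, hn0⟩ := ((hlim.eventually (ge_mem_nhds one_pos)).and
        (Filter.eventually_gt_atTop 0)).exists
      refine ⟨m * n, Nat.mul_pos hm hn0, (han n).trans ?_⟩
      exact mul_le_of_le_one_left (by positivity) hn
  obtain ⟨j, hj⟩ : ∃ j : ℕ, M / μ ^ j < 1 := by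
    obtain ⟨j, hj⟩ := pow_unbounded_of_one_lt M hμ
    exact ⟨j, (div_lt_one (by positivity)).2 hj⟩
  obtain ⟨m, hm, ham⟩ := step j
  have : (0 : ℝ) < max (1 / 2) (M / μ ^ j) := lt_max_of_lt_left (by norm_num)
  exact ⟨m, hm, ham.trans_lt (pow_lt_one₀ this.le (max_lt (by norm_num) hj) hm.ne')⟩

/-! ### Concave weights: cutting off the slope and using weak growth. -/

namespace AdmissibleWeight

variable (ω : AdmissibleWeight d)

/-- Increments of the concave function `ρ` decrease. -/
theorem rho_increment_anti {u a h : ℝ} (hu : 0 ≤ u) (hua : u ≤ a) (hh : 0 ≤ h) :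
    ω.rho (a + h) - ω.rho (u + h) ≤ ω.rho a - ω.rho u := by
  rcases (add_nonneg (sub_nonneg.2 hua) hh).eq_or_lt with h0 | h0
  · have : h = 0 := by linarith
    simp [this]
  -- Both `a` and `u + h` lie between `u` and `a + h`, with interchanged convex coefficients; adding
  -- the two concavity inequalities gives the claim.
  · have h1 := ω.rho_concaveOn.2 (Set.mem_Ici.2 hu) (Set.mem_Ici.2 (show 0 ≤ a + h by linarith))
      (show 0 ≤ h / (a - u + h) by positivity)
      (show 0 ≤ (a - u) / (a - u + h) by apply div_nonneg <;> linarith) (by field_simp; ring)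
    have h2 := ω.rho_concaveOn.2 (Set.mem_Ici.2 hu) (Set.mem_Ici.2 (show 0 ≤ a + h by linarith))
      (show 0 ≤ (a - u) / (a - u + h) by apply div_nonneg <;> linarith)
      (show 0 ≤ h / (a - u + h) by positivity) (by field_simp)
    have e1 : (h / (a - u + h)) • u + ((a - u) / (a - u + h)) • (a + h) = a := by
      simp only [smul_eq_mul]; field_simp; ring
    have e2 : ((a - u) / (a - u + h)) • u + (h / (a - u + h)) • (a + h) = u + h := by
      simp only [smul_eq_mul]; field_simp; ring
    rw [e1] at h1
    rw [e2] at h2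
    simp only [smul_eq_mul] at h1 h2
    have e3 : (a - u) / (a - u + h) = 1 - h / (a - u + h) := by field_simp; ring
    rw [e3] at h1 h2
    nlinarith

/-- The function `ρ` with its slope cut off at `s`. -/
def cutRho (s t : ℝ) : ℝ := ⨅ u : Set.Icc (0 : ℝ) t, (s * u + ω.rho t - ω.rho u)

theorem cutRho_bddBelow {s : ℝ} (hs : 0 ≤ s) (t : ℝ) :
    BddBelow (Set.range fun u : Set.Icc (0 : ℝ) t => s * u + ω.rho t - ω.rho u) := by
  refine ⟨0, ?_⟩
  rintro _ ⟨u, rfl⟩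
  have := ω.rho_mono u.2.1 u.2.2
  have := mul_nonneg hs u.2.1
  dsimp only
  linarith

theorem cutRho_le {s : ℝ} (hs : 0 ≤ s) {t u : ℝ} (hu : 0 ≤ u) (hut : u ≤ t) :
    ω.cutRho s t ≤ s * u + ω.rho t - ω.rho u :=
  ciInf_le (ω.cutRho_bddBelow hs t) (⟨u, hu, hut⟩ : Set.Icc (0 : ℝ) t)

theorem le_cutRho {s t c : ℝ} (ht : 0 ≤ t)
    (h : ∀ u, 0 ≤ u → u ≤ t → c ≤ s * u + ω.rho t - ω.rho u) : c ≤ ω.cutRho s t := by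
  have : Nonempty (Set.Icc (0 : ℝ) t) := ⟨⟨0, le_rfl, ht⟩⟩
  exact le_ciInf fun u => h u u.2.1 u.2.2

/-- Given competitors `u` and `v` for `a` and `b`, use `u + v` as a competitor for `t` if it does
not exceed `t`, and `t` itself otherwise. In the first case decreasing increments of `ρ` bound `ρ (a
+ b) - ρ (u + v)`. Allowing `t ≤ a + b` is what the triangle inequality for the norm calls for. -/
theorem cutRho_subadditive {s : ℝ} (hs : 0 ≤ s) {a b t : ℝ} (ha : 0 ≤ a) (hb : 0 ≤ b)
    (ht : 0 ≤ t) (htab : t ≤ a + b) : ω.cutRho s t ≤ ω.cutRho s a + ω.cutRho s b := by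
  have : Nonempty (Set.Icc (0 : ℝ) a) := ⟨⟨0, le_rfl, ha⟩⟩
  have : Nonempty (Set.Icc (0 : ℝ) b) := ⟨⟨0, le_rfl, hb⟩⟩
  refine le_ciInf_add_ciInf fun u v => ?_
  obtain ⟨u, hu0, hua⟩ := u
  obtain ⟨v, hv0, hvb⟩ := v
  dsimp only
  rcases le_total (u + v) t with h | h
  · have h1 := ω.cutRho_le hs (add_nonneg hu0 hv0) h
    have h2 := ω.rho_mono ht htab
    have h3 := ω.rho_increment_anti hu0 hua hb
    have h4 := ω.rho_increment_anti hv0 hvb hu0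
    rw [add_comm b u, add_comm v u] at h4
    linarith
  · have h1 := ω.cutRho_le hs ht le_rfl
    have h2 := ω.rho_mono hu0 hua
    have h3 := ω.rho_mono hv0 hvb
    have h4 := mul_le_mul_of_nonneg_left h hs
    linarith

/-- The Gelfand-Raikov-Shilov condition makes `ρ` sublinear on the values of the norm. -/
theorem exists_rho_le {s : ℝ} (hs : 0 < s) :
    ∃ c, ∀ (x : Fin d → ℝ) (u : ℝ), 0 ≤ u → u ≤ ω.nrm x → ω.rho u ≤ s * u + c := by
  by_cases hx : ∃ x, ω.nrm x ≠ 0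
  · obtain ⟨x, hx⟩ := hx
    set a := ω.nrm x with ha
    have ha0 : 0 < a := lt_of_le_of_ne (apply_nonneg _ _) (Ne.symm hx)
    have hev : ∀ᶠ n : ℕ in Filter.atTop, ω.rho (n * a) ≤ s * a * n := by
      have h1 : (1 : ℝ) < Real.exp (s * a) := Real.one_lt_exp_iff.2 (by positivity)
      filter_upwards [(ω.grs x).eventually (gt_mem_nhds h1), Filter.eventually_gt_atTop 0]
        with n hn hn0
      have hn0' : (0 : ℝ) < n := by exact_mod_cast hn0
      rw [← Real.exp_mul, Real.exp_lt_exp, map_smul_eq_mul, Real.norm_natCast, mul_one_div,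
        div_lt_iff₀ hn0'] at hn
      exact hn.le
    obtain ⟨N, hN⟩ := Filter.eventually_atTop.1 hev
    refine ⟨s * a * (N + 1), fun _ u hu _ => ?_⟩
    -- Large enough both for `u ≤ n * a` and for the threshold `N`; the excess over `u / a` is
    -- bounded and goes into the constant.
    set n := ⌈u / a⌉₊ + N with hn
    have h1 : u ≤ n * a := by
      have := Nat.le_ceil (u / a)
      rw [div_le_iff₀ ha0] at this
      push_cast [hn]
      nlinarith [Nat.cast_nonneg (α := ℝ) N]
    have h2 : (n : ℝ) ≤ u / a + 1 + N := by
      have := Nat.ceil_lt_add_one (div_nonneg hu ha0.le)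
      push_cast [hn]
      linarith
    calc ω.rho u ≤ ω.rho (n * a) := ω.rho_mono hu h1
      _ ≤ s * a * n := hN n (by omega)
      _ ≤ s * a * (u / a + 1 + N) := by gcongr
      _ = s * u + s * a * (N + 1) := by field_simp; ring
  -- If the norm vanishes identically (dimension 0), the growth condition says nothing about `ρ`;
  -- this is why `u` is restricted to values below `ω.nrm x`.
  · push Not at hx
    refine ⟨0, fun x u hu hux => ?_⟩
    have : u = 0 := le_antisymm (hux.trans (hx x).le) hu
    simp [this, ω.rho_zero]

/-- Equivalence of norms in finite dimension: a definite continuous seminorm has a positive minimum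
on the unit sphere, which is empty only in dimension 0. -/
theorem exists_norm_le_nrm : ∃ c, 0 < c ∧ ∀ x : Fin d → ℝ, ‖x‖ ≤ c * ω.nrm x := by
  have hcont : Continuous ω.nrm := by
    have := ω.nrm.convexOn
    exact continuousOn_univ.1 (this.continuousOn isOpen_univ)
  rcases (Metric.sphere (0 : Fin d → ℝ) 1).eq_empty_or_nonempty with h | h
  · refine ⟨1, one_pos, fun x => ?_⟩
    by_cases hx : x = 0
    · simp [hx]
    · exfalso
      have : ‖x‖⁻¹ • x ∈ Metric.sphere (0 : Fin d → ℝ) 1 := by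
        simp [norm_smul, hx]
      rw [h] at this
      exact this
  · obtain ⟨y, hy, hmin⟩ := (isCompact_sphere (0 : Fin d → ℝ) 1).exists_isMinOn h hcont.continuousOn
    have hy1 : ‖y‖ = 1 := by simpa using hy
    have hy0 : 0 < ω.nrm y := by
      refine lt_of_le_of_ne (apply_nonneg _ _) fun h0 => ?_
      rw [ω.nrm_definite y h0.symm] at hy1
      simp at hy1
    refine ⟨(ω.nrm y)⁻¹, inv_pos.2 hy0, fun x => ?_⟩
    by_cases hx : x = 0
    · simp [hx]
    · have hx' : 0 < ‖x‖ := norm_pos_iff.2 hx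
      have hm : ω.nrm y ≤ ω.nrm (‖x‖⁻¹ • x) := hmin (by simp [norm_smul, hx])
      rw [map_smul_eq_mul, norm_inv, norm_norm, inv_mul_eq_div, le_div_iff₀ hx'] at hm
      rw [inv_mul_eq_div, le_div_iff₀ hy0]
      linarith

variable {ω}

/-- Under weak growth, a power of the sup norm is dominated by the weight. -/
theorem WeakGrowth.exists_enorm_rpow_le (hω : ω.WeakGrowth) {p : ℝ} (hp : 0 < p) (hp1 : p ≤ 1) :
    ∃ s : ℝ, 0 < s ∧ s ≤ 1 ∧ ∃ c : ℝ≥0∞, c ≠ ⊤ ∧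
      ∀ x : Fin d → ℤ, ‖x‖ₑ ^ s ≤ c * ENNReal.ofReal (ω.onInt x) ^ p := by
  obtain ⟨C, δ, hC, hδ, hδ1, h⟩ := hω
  obtain ⟨c, hc, hnrm⟩ := ω.exists_norm_le_nrm
  refine ⟨δ * p, by positivity, by nlinarith, ENNReal.ofReal (c ^ δ / C) ^ p,
    (ENNReal.rpow_lt_top_of_nonneg hp.le ENNReal.ofReal_ne_top).ne, fun x => ?_⟩
  rw [ENNReal.rpow_mul, ← ENNReal.mul_rpow_of_nonneg _ _ hp.le,
    ← ENNReal.ofReal_mul (by positivity)]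
  refine ENNReal.rpow_le_rpow ?_ hp.le
  rw [← ofReal_norm, ENNReal.ofReal_rpow_of_nonneg (norm_nonneg _) hδ.le]
  refine ENNReal.ofReal_le_ofReal ?_
  have h1 : ‖x‖ ≤ c * ω.nrm (toReal x) := by
    refine le_trans ?_ (hnrm (toReal x))
    refine (pi_norm_le_iff_of_nonneg (norm_nonneg _)).2 fun i => ?_
    have := norm_le_pi_norm (toReal x) i
    rwa [toReal, Int.norm_cast_real] at this
  calc ‖x‖ ^ δ ≤ (c * (1 + ω.nrm (toReal x))) ^ δ := by
        gcongr
        linarith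
    _ = c ^ δ / C * (C * (1 + ω.nrm (toReal x)) ^ δ) := by
        rw [Real.mul_rpow hc.le (by positivity)]
        field_simp
    _ ≤ c ^ δ / C * ω.onInt x := by
        gcongr
        exact h x

/-- Weak growth forces `ρ` to be large at any lattice point of large norm. The first alternative
covers the degenerate case where lattice norms are bounded. -/
theorem WeakGrowth.exists_le_rho (hω : ω.WeakGrowth) (K : ℝ) :
    ∃ U, 0 ≤ U ∧ ∀ x : Fin d → ℤ, ω.nrm (toReal x) ≤ U ∨ K ≤ ω.rho U := by
  obtain ⟨C, δ, hC, hδ, hδ1, h⟩ := hω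
  set U := (Real.exp K / C) ^ δ⁻¹ with hU
  have hU0 : 0 ≤ U := by positivity
  by_cases hx : ∃ x : Fin d → ℤ, U < ω.nrm (toReal x)
  · obtain ⟨x, hx⟩ := hx
    refine ⟨ω.nrm (toReal x), apply_nonneg _ _, fun y => Or.inr ?_⟩
    have h1 := h x
    rw [onInt, fn] at h1
    rw [← Real.exp_le_exp]
    refine le_trans ?_ h1
    have h2 : Real.exp K / C ≤ (1 + ω.nrm (toReal x)) ^ δ := by
      calc Real.exp K / C = U ^ δ := by
            rw [hU, ← Real.rpow_mul (by positivity), inv_mul_cancel₀ hδ.ne', Real.rpow_one]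
        _ ≤ _ := by gcongr; linarith
    rw [div_le_iff₀ hC] at h2
    linarith
  · push Not at hx
    exact ⟨U, hU0, fun x => Or.inl (hx x)⟩

/-- There are submultiplicative weights equivalent to `ω ^ p` and arbitrarily close to `1` up to a
small multiple of `ω ^ p`. -/
theorem WeakGrowth.exists_equivalent_weight (hω : ω.WeakGrowth) {p : ℝ} (hp : 0 < p) {ε : ℝ}
    (hε : 0 < ε) :
    ∃ v : (Fin d → ℤ) → ℝ≥0∞, v 0 ≤ 1 ∧ (∀ x y, v (x + y) ≤ v x * v y) ∧
      (∃ c : ℝ≥0∞, c ≠ ⊤ ∧ ∀ x, ENNReal.ofReal (ω.onInt x) ^ p ≤ c * v x) ∧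
      ∀ x, v x ≤ ENNReal.ofReal (1 + ε) + ENNReal.ofReal ε * ENNReal.ofReal (ω.onInt x) ^ p := by
  obtain ⟨U, hU0, hU⟩ := hω.exists_le_rho (Real.log ((1 + ε) / ε) / p)
  -- The slope is small enough that the cut-off weight stays below `1 + ε` up to radius `U`; `U + 1`
  -- avoids division by 0.
  set s := Real.log (1 + ε) / (p * (U + 1)) with hs
  have hs0 : 0 < s := div_pos (Real.log_pos (by linarith)) (by positivity)
  have hsU : p * (s * U) ≤ Real.log (1 + ε) := by
    have : p * (s * (U + 1)) = Real.log (1 + ε) := by rw [hs]; field_simp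
    nlinarith [mul_pos hp hs0]
  have hN : ∀ x : Fin d → ℤ, 0 ≤ ω.nrm (toReal x) := fun x => apply_nonneg _ _
  have hωp : ∀ x, ENNReal.ofReal (ω.onInt x) ^ p =
      ENNReal.ofReal (Real.exp (p * ω.rho (ω.nrm (toReal x)))) := fun x => by
    rw [ENNReal.ofReal_rpow_of_nonneg (ω.onInt_pos x).le hp.le, onInt, fn, ← Real.exp_mul, mul_comm]
  refine ⟨fun x => ENNReal.ofReal (Real.exp (p * ω.cutRho s (ω.nrm (toReal x)))), ?_, ?_, ?_, ?_⟩
  · have h0 : ω.nrm (toReal (0 : Fin d → ℤ)) = 0 := by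
      have : toReal (0 : Fin d → ℤ) = 0 := by ext i; simp [toReal]
      rw [this, map_zero]
    have h1 := ω.cutRho_le hs0.le (le_refl (0 : ℝ)) le_rfl
    rw [mul_zero, zero_add, sub_self] at h1
    refine ENNReal.ofReal_le_one.2 (Real.exp_le_one_iff.2 ?_)
    rw [h0]
    exact mul_nonpos_of_nonneg_of_nonpos hp.le h1
  · intro x y
    rw [← ENNReal.ofReal_mul (Real.exp_pos _).le, ← Real.exp_add, ← mul_add]
    have hxy : toReal (x + y) = toReal x + toReal y := by ext i; simp [toReal]
    have hle : ω.nrm (toReal (x + y)) ≤ ω.nrm (toReal x) + ω.nrm (toReal y) := by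
      rw [hxy]
      exact map_add_le_add _ _ _
    refine ENNReal.ofReal_le_ofReal (Real.exp_le_exp.2 (mul_le_mul_of_nonneg_left ?_ hp.le))
    exact ω.cutRho_subadditive hs0.le (hN x) (hN y) (hN _) hle
  · obtain ⟨c, hc⟩ := ω.exists_rho_le hs0
    refine ⟨ENNReal.ofReal (Real.exp (p * c)), ENNReal.ofReal_ne_top, fun x => ?_⟩
    rw [hωp, ← ENNReal.ofReal_mul (Real.exp_pos _).le, ← Real.exp_add, ← mul_add]
    refine ENNReal.ofReal_le_ofReal (Real.exp_le_exp.2 (mul_le_mul_of_nonneg_left ?_ hp.le))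
    have : ω.rho (ω.nrm (toReal x)) - c ≤ ω.cutRho s (ω.nrm (toReal x)) :=
      ω.le_cutRho (hN x) fun u hu hux => by linarith [hc (toReal x) u hu hux]
    linarith
  · intro x
    rw [hωp, ← ENNReal.ofReal_mul hε.le, ← ENNReal.ofReal_add (by linarith) (by positivity)]
    refine ENNReal.ofReal_le_ofReal ?_
    set t := ω.nrm (toReal x)
    have hexp : Real.exp (Real.log (1 + ε)) = 1 + ε := Real.exp_log (by linarith)
    by_cases htU : t ≤ U
    -- Inside radius `U` use the purely linear competitor `u = t`.
    · have h1 := ω.cutRho_le hs0.le (hN x) le_rfl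
      have h2 : p * ω.cutRho s t ≤ Real.log (1 + ε) := by
        refine le_trans ?_ hsU
        gcongr
        nlinarith
      have h3 := Real.exp_le_exp.2 h2
      rw [hexp] at h3
      have : 0 ≤ ε * Real.exp (p * ω.rho t) := by positivity
      linarith
    -- Beyond radius `U` switch from slope `s` to `ρ` at `u = U`. The choice of `U` makes `exp (-p *
    -- ρ U)` at most `ε / (1 + ε)`, which cancels the factor `1 + ε` from the linear part.
    · have h := (hU x).resolve_left htU
      have h1 := ω.cutRho_le hs0.le hU0 (not_le.1 htU).le
      rw [div_le_iff₀ hp] at h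
      have h2 : p * ω.cutRho s t ≤
          Real.log (1 + ε) + p * ω.rho t - Real.log ((1 + ε) / ε) := by
        nlinarith [mul_le_mul_of_nonneg_left h1 hp.le]
      have h3 := Real.exp_le_exp.2 h2
      rw [Real.exp_sub, Real.exp_add, hexp, Real.exp_log (by positivity)] at h3
      have h4 : (1 + ε) * Real.exp (p * ω.rho t) / ((1 + ε) / ε) =
          ε * Real.exp (p * ω.rho t) := by field_simp
      linarith

end AdmissibleWeight

/-! ### Invertibility of `1 - A` for operator norm below 1. -/

instance : Nontrivial (L2 d) :=
  ⟨lp.single 2 0 1, 0, fun h => by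
    have h1 := BeurlingAlgebra.single_self (0 : Fin d → ℤ) 1
    rw [h] at h1
    simp at h1⟩

namespace BeurlingAlgebra

variable {p : Set.Ioc (0 : ℝ) 1} {ω : AdmissibleWeight d}

theorem schurNorm_pow_le {w : (Fin d → ℤ) → ℝ≥0∞} (hw0 : w 0 ≤ 1)
    (hw : ∀ x y, w (x + y) ≤ w x * w y) (A : BeurlingAlgebra p ω) (n : ℕ) :
    schurNorm p w (A ^ n).mat ≤ schurNorm p w A.mat ^ n := by
  induction n with
  | zero =>
    rw [pow_zero, pow_zero, mat_one]
    exact schurNorm_one_le p.2.1 hw0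
  | succ n ih =>
    rw [pow_succ, pow_succ, mat_mul]
    exact (schurNorm_matMul_le p.2.1 p.2.2 hw).trans (by gcongr)

theorem schurNorm_lt_top {w : (Fin d → ℤ) → ℝ≥0∞} {c : ℝ≥0∞} (hc : c ≠ ⊤)
    (hw : ∀ x, w x ≤ c * ENNReal.ofReal (ω.onInt x) ^ (p : ℝ)) (A : BeurlingAlgebra p ω) :
    schurNorm p w A.mat < ⊤ := by
  have h := A.mat_lt_top
  rw [pNorm_eq_schurNorm p.2.1] at h
  exact (schurNorm_le_mul hw).trans_lt (ENNReal.mul_lt_top hc.lt_top h)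

theorem one_le_ofReal_onInt_rpow (x : Fin d → ℤ) :
    1 ≤ ENNReal.ofReal (ω.onInt x) ^ (p : ℝ) :=
  ENNReal.one_le_rpow (ENNReal.one_le_ofReal.2 (ω.one_le_onInt x)) p.2.1

theorem norm_mat_le (A : BeurlingAlgebra p ω) (k l : Fin d → ℤ) : ‖A.mat k l‖ ≤ ‖toOp p ω A‖ := by
  have h := op_single A 1 k l
  rw [mul_one] at h
  rw [← h]
  refine (lp.norm_apply_le_norm (by norm_num) _ k).trans ?_
  refine ((toOp p ω A).le_opNorm _).trans ?_
  rw [lp.norm_single (by norm_num), norm_one, mul_one]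

/-- Elements of operator norm less than `1` have a power of unweighted Schur norm less than `1`. -/
theorem exists_pow_schurNorm_lt_one (hω : ω.WeakGrowth) {A : BeurlingAlgebra p ω}
    (hA : ‖toOp p ω A‖ < 1) : ∃ m, 0 < m ∧ schurNorm p (fun _ => 1) (A ^ m).mat < 1 := by
  obtain ⟨s, hs0, hs1, c, hc, hτ⟩ := hω.exists_enorm_rpow_le p.2.1 p.2.2
  have hp0 : (0 : ℝ) < p := p.2.1
  -- Chosen so that `η ^ p = 1 / (4 * 2 ^ d)`: the factor `2 ^ d` offsets the number of positions in
  -- a band of radius `2 ^ n`, and `1/4` is the rate the iteration requires.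
  set η : ℝ := (1 / (4 * 2 ^ d)) ^ (p : ℝ)⁻¹ with hη
  have hη0 : 0 < η := by positivity
  obtain ⟨q, hq, hq0⟩ : ∃ q : ℕ, ‖toOp p ω A‖ ^ q < η ∧ 0 < q :=
    (((tendsto_pow_atTop_nhds_zero_of_lt_one (norm_nonneg _) hA).eventually
      (gt_mem_nhds hη0)).and (Filter.eventually_gt_atTop 0)).exists
  set B := A ^ q with hB
  have hBn : ∀ n k l, ‖(B ^ n).mat k l‖ₑ ≤ ENNReal.ofReal (η ^ n) := by
    intro n k l
    rw [← ofReal_norm]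
    refine ENNReal.ofReal_le_ofReal ((norm_mat_le _ k l).trans ?_)
    rw [hB, ← pow_mul, map_pow]
    refine (norm_pow_le _ _).trans ?_
    rw [pow_mul]
    gcongr
  have hone : ∀ n, schurNorm p (fun _ => 1) (B ^ n).mat < ⊤ := fun n =>
    schurNorm_lt_top ENNReal.one_ne_top (fun x => by
      simpa using one_le_ofReal_onInt_rpow (p := p) (ω := ω) x) _
  have htau : ∀ n, schurNorm p (fun x => ‖x‖ₑ ^ s) (B ^ n).mat < ⊤ := fun n =>
    schurNorm_lt_top hc hτ _
  set a : ℕ → ℝ := fun n => (schurNorm p (fun _ => 1) (B ^ n).mat).toReal with ha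
  set b : ℕ → ℝ := fun n => (schurNorm p (fun x => ‖x‖ₑ ^ s) (B ^ n).mat).toReal with hb
  have haE : ∀ n, schurNorm p (fun _ => 1) (B ^ n).mat = ENNReal.ofReal (a n) := fun n =>
    (ENNReal.ofReal_toReal (hone n).ne).symm
  have hbE : ∀ n, schurNorm p (fun x => ‖x‖ₑ ^ s) (B ^ n).mat = ENNReal.ofReal (b n) := fun n =>
    (ENNReal.ofReal_toReal (htau n).ne).symm
  have ha0 : ∀ n, 0 ≤ a n := fun n => ENNReal.toReal_nonneg
  have hb0 : ∀ n, 0 ≤ b n := fun n => ENNReal.toReal_nonneg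
  -- With band radius `2 ^ n`, the off-band part gains `2 ^ (-s * n)`, that is, `(μ ^ 3) ^ n` in the
  -- denominator.
  set μ : ℝ := 2 ^ (s / 3) with hμ
  have hμ1 : 1 < μ := Real.one_lt_rpow (by norm_num) (by positivity)
  have hμ3 : μ ^ 3 = 2 ^ s := by
    rw [hμ, ← Real.rpow_natCast, ← Real.rpow_mul (by norm_num)]
    congr 1
    push_cast
    ring
  have h1 : ∀ ε, 0 < ε → ∀ m n, ε * b (m * n) ≤ (a m + ε * b m) ^ n := by
    intro ε hε m n
    have hle : ENNReal.ofReal ε * schurNorm p (fun x => ‖x‖ₑ ^ s) (B ^ (m * n)).mat ≤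
        (schurNorm p (fun _ => 1) (B ^ m).mat +
          ENNReal.ofReal ε * schurNorm p (fun x => ‖x‖ₑ ^ s) (B ^ m).mat) ^ n := by
      simp only [← schurNorm_const_mul_weight]
      calc _ ≤ schurNorm p (fun x : Fin d → ℤ => 1 + ENNReal.ofReal ε * ‖x‖ₑ ^ s)
            (B ^ (m * n)).mat := schurNorm_mono fun x => le_add_self
        _ ≤ schurNorm p (fun x : Fin d → ℤ => 1 + ENNReal.ofReal ε * ‖x‖ₑ ^ s)
            (B ^ m).mat ^ n := by
          rw [pow_mul]
          refine schurNorm_pow_le (by simp [hs0]) (fun x y => ?_) _ n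
          -- Subadditivity of `‖x‖ ^ s`, valid as `s ≤ 1`, gives submultiplicativity after adding
          -- the nonnegative cross term.
          calc 1 + ENNReal.ofReal ε * ‖x + y‖ₑ ^ s
              ≤ 1 + ENNReal.ofReal ε * (‖x‖ₑ ^ s + ‖y‖ₑ ^ s) := by
                gcongr
                exact (ENNReal.rpow_le_rpow (enorm_add_le _ _) hs0.le).trans
                  (ENNReal.rpow_add_le_add_rpow _ _ hs0.le hs1)
            _ ≤ 1 + ENNReal.ofReal ε * (‖x‖ₑ ^ s + ‖y‖ₑ ^ s) +
                ENNReal.ofReal ε * ‖x‖ₑ ^ s * (ENNReal.ofReal ε * ‖y‖ₑ ^ s) := le_self_add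
            _ = _ := by ring
        _ ≤ _ := by
          gcongr
          exact schurNorm_add_weight_le
    rw [haE, hbE, hbE, ← ENNReal.ofReal_mul hε.le, ← ENNReal.ofReal_mul hε.le,
      ← ENNReal.ofReal_add (ha0 m) (mul_nonneg hε.le (hb0 m)),
      ← ENNReal.ofReal_pow (add_nonneg (ha0 m) (mul_nonneg hε.le (hb0 m))),
      ENNReal.ofReal_le_ofReal_iff
        (pow_nonneg (add_nonneg (ha0 m) (mul_nonneg hε.le (hb0 m))) n)] at hle
    exact hle
  have h2 : ∀ n, a n ≤ 4 ^ d * (1 / 4) ^ n + ((μ ^ 3) ^ n)⁻¹ * b n := by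
    intro n
    have hle := schurNorm_band_le (hBn n) hp0 hs0 (2 ^ n) (by positivity)
    have e1 : (2 * ((2 ^ n : ℕ) : ℝ≥0∞) + 1) ^ d * ENNReal.ofReal (η ^ n) ^ (p : ℝ) ≤
        ENNReal.ofReal (4 ^ d * (1 / 4) ^ n) := by
      rw [ENNReal.ofReal_rpow_of_nonneg (by positivity) hp0.le]
      have h1 : (2 * ((2 ^ n : ℕ) : ℝ≥0∞) + 1) ^ d = ENNReal.ofReal ((2 * 2 ^ n + 1) ^ d) := by
        rw [ENNReal.ofReal_pow (by positivity), ENNReal.ofReal_add (by positivity) (by norm_num),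
          ENNReal.ofReal_mul (by norm_num), ENNReal.ofReal_pow (by norm_num)]
        norm_num
      rw [h1, ← ENNReal.ofReal_mul (by positivity)]
      refine ENNReal.ofReal_le_ofReal ?_
      have h2 : (η ^ n) ^ (p : ℝ) = (1 / (4 * 2 ^ d)) ^ n := by
        rw [← Real.rpow_pow_comm hη0.le, hη, ← Real.rpow_mul (by positivity),
          inv_mul_cancel₀ hp0.ne', Real.rpow_one]
      have h3 : (2 * 2 ^ n + 1 : ℝ) ≤ 4 * 2 ^ n := by
        have : (1 : ℝ) ≤ 2 ^ n := one_le_pow₀ (by norm_num)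
        linarith
      rw [h2]
      calc (2 * 2 ^ n + 1 : ℝ) ^ d * (1 / (4 * 2 ^ d)) ^ n
          ≤ (4 * 2 ^ n) ^ d * (1 / (4 * 2 ^ d)) ^ n := by gcongr
        _ = 4 ^ d * (1 / 4) ^ n := by
          rw [mul_pow, ← pow_mul, mul_comm n d, pow_mul, mul_assoc, ← mul_pow]
          congr 2
          field_simp
    have e2 : (((2 ^ n : ℕ) : ℝ≥0∞) ^ s)⁻¹ = ENNReal.ofReal (((μ ^ 3) ^ n)⁻¹) := by
      rw [ENNReal.ofReal_inv_of_pos (by positivity), hμ3, ← Real.rpow_natCast,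
        ← Real.rpow_mul (by norm_num), mul_comm, Real.rpow_mul (by norm_num), Real.rpow_natCast,
        ← ENNReal.ofReal_rpow_of_nonneg (by positivity) hs0.le, ENNReal.ofReal_pow (by norm_num)]
      norm_num
    have h := hle.trans (add_le_add_left e1 _)
    rw [e2, haE, hbE, ← ENNReal.ofReal_mul (by positivity),
      ← ENNReal.ofReal_add (by positivity) (mul_nonneg (by positivity) (hb0 n)),
      ENNReal.ofReal_le_ofReal_iff
        (add_nonneg (by positivity) (mul_nonneg (by positivity) (hb0 n)))] at h
    exact h
  obtain ⟨m, hm, ham⟩ := exists_lt_one_of_interpolation (by positivity) hb0 ha0 hμ1 h1 h2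
  refine ⟨q * m, Nat.mul_pos hq0 hm, ?_⟩
  rw [pow_mul, ← hB, haE]
  simpa using ham

/-- The Neumann series converges in the algebra if it converges for an equivalent submultiplicative
Schur norm. -/
theorem isUnit_one_sub_of_schurNorm_lt_one {v : (Fin d → ℤ) → ℝ≥0∞} (hv0 : v 0 ≤ 1)
    (hv : ∀ x y, v (x + y) ≤ v x * v y) {c : ℝ≥0∞} (hc : c ≠ ⊤)
    (hcv : ∀ x, ENNReal.ofReal (ω.onInt x) ^ (p : ℝ) ≤ c * v x) {B : BeurlingAlgebra p ω}
    (hB : ‖toOp p ω B‖ < 1) (hBv : schurNorm p v B.mat < 1) : IsUnit (1 - B) := by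
  set D : Matrix (Fin d → ℤ) (Fin d → ℤ) ℂ := fun k l => ∑' n, (B ^ n).mat k l with hD
  have hfin : pNorm p ω D < ⊤ := by
    rw [pNorm_eq_schurNorm p.2.1]
    calc _ ≤ c * schurNorm p v D := schurNorm_le_mul hcv
      _ ≤ c * ∑' n, schurNorm p v (B ^ n).mat := by
        gcongr
        exact schurNorm_tsum_le p.2.1 p.2.2 fun n => (B ^ n).mat
      _ ≤ c * ∑' n, schurNorm p v B.mat ^ n := by
        gcongr with n
        exact schurNorm_pow_le hv0 hv B n
      _ < ⊤ := by
        rw [ENNReal.tsum_geometric]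
        refine ENNReal.mul_lt_top hc.lt_top ?_
        rw [ENNReal.inv_lt_top]
        exact tsub_pos_of_lt hBv
  set C : BeurlingAlgebra p ω := ⟨D, hfin⟩ with hC
  have hsum := summable_geometric_of_norm_lt_one (x := toOp p ω B) hB
  -- The operator series converges in norm, so its matrix coefficients are the entrywise sums. The
  -- inverse identities can then be checked on operators and pulled back by injectivity.
  have hCop : toOp p ω C = ∑' n, toOp p ω B ^ n := by
    refine op_ext fun l z k => ?_
    have h1 : toOp p ω C (lp.single 2 l z) k = (∑' n, (B ^ n).mat k l) * z := op_single C z k l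
    let ev : (L2 d →L[ℂ] L2 d) →L[ℂ] ℂ :=
      (lp.evalCLM ℂ (fun _ : Fin d → ℤ => ℂ) 2 k).comp
        (ContinuousLinearMap.apply ℂ (L2 d) (lp.single 2 l z : L2 d))
    have hev : ∀ T, ev T = T (lp.single 2 l z) k := fun T => rfl
    rw [h1, ← hev, ev.map_tsum hsum, ← tsum_mul_right]
    refine tsum_congr fun n => ?_
    rw [hev, ← map_pow]
    exact (op_single (B ^ n) z k l).symm
  refine ⟨⟨1 - B, C, toOp_injective ?_, toOp_injective ?_⟩, rfl⟩
  · rw [map_mul, map_sub, map_one, hCop]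
    exact mul_neg_geom_series _ hB
  · rw [map_mul, map_sub, map_one, hCop]
    exact geom_series_mul_neg _ hB

/-- A suitable power `B` of `A` has unweighted norm below 1. The equivalent weight is at most `(1 +
ε) + ε * ω ^ p`, so a small `ε` keeps the corresponding norm of `B` below 1, and `1 - B` is a unit.
-/
theorem isUnit_one_sub (hω : ω.WeakGrowth) {A : BeurlingAlgebra p ω} (hA : ‖toOp p ω A‖ < 1) :
    IsUnit (1 - A) := by
  obtain ⟨m, hm, hAm⟩ := exists_pow_schurNorm_lt_one hω hA
  set B := A ^ m with hB
  have hBop : ‖toOp p ω B‖ < 1 := by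
    rw [hB, map_pow]
    exact (norm_pow_le' _ hm).trans_lt (pow_lt_one₀ (norm_nonneg _) hA hm.ne')
  have hBω : schurNorm p (fun x => ENNReal.ofReal (ω.onInt x) ^ (p : ℝ)) B.mat < ⊤ :=
    schurNorm_lt_top ENNReal.one_ne_top (fun x => (one_mul _).ge) B
  set α := (schurNorm p (fun _ => 1) B.mat).toReal with hα
  set β := (schurNorm p (fun x => ENNReal.ofReal (ω.onInt x) ^ (p : ℝ)) B.mat).toReal with hβ
  have hα0 : 0 ≤ α := ENNReal.toReal_nonneg
  have hβ0 : 0 ≤ β := ENNReal.toReal_nonneg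
  have hαE : schurNorm p (fun _ => 1) B.mat = ENNReal.ofReal α :=
    (ENNReal.ofReal_toReal (hAm.trans ENNReal.one_lt_top).ne).symm
  have hβE : schurNorm p (fun x => ENNReal.ofReal (ω.onInt x) ^ (p : ℝ)) B.mat =
      ENNReal.ofReal β := (ENNReal.ofReal_toReal hBω.ne).symm
  have hα1 : α < 1 := by
    rw [hαE] at hAm
    simpa using hAm
  obtain ⟨ε, hε, hε1⟩ : ∃ ε, 0 < ε ∧ (1 + ε) * α + ε * β < 1 := by
    refine ⟨(1 - α) / (α + β + 1), div_pos (by linarith) (by linarith), ?_⟩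
    have : (1 - α) / (α + β + 1) * (α + β) < 1 - α := by
      rw [div_mul_eq_mul_div, div_lt_iff₀ (by linarith)]
      nlinarith
    linarith
  obtain ⟨v, hv0, hv, ⟨c, hc, hcv⟩, hvε⟩ := hω.exists_equivalent_weight p.2.1 hε
  have hBv : schurNorm p v B.mat < 1 := by
    calc schurNorm p v B.mat ≤ _ := schurNorm_mono hvε
      _ ≤ schurNorm p (fun _ => ENNReal.ofReal (1 + ε) * 1) B.mat + schurNorm p
          (fun x => ENNReal.ofReal ε * ENNReal.ofReal (ω.onInt x) ^ (p : ℝ)) B.mat := by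
        simp only [mul_one]
        exact schurNorm_add_weight_le
      _ = ENNReal.ofReal ((1 + ε) * α + ε * β) := by
        rw [schurNorm_const_mul_weight (w := fun _ => 1), schurNorm_const_mul_weight, hαE, hβE,
          ← ENNReal.ofReal_mul (by positivity), ← ENNReal.ofReal_mul (by positivity),
          ← ENNReal.ofReal_add (by positivity) (by positivity)]
      _ < 1 := by simpa using hε1
  have h1 := isUnit_one_sub_of_schurNorm_lt_one hv0 hv hc hcv hBop hBv
  -- `1 - A` is a factor of `1 - A ^ m` commuting with its cofactor, so it inherits invertibility.
  rw [hB, ← mul_neg_geom_sum] at h1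
  refine ((Commute.isUnit_mul_iff ?_).1 h1).1
  rw [Commute, SemiconjBy, mul_neg_geom_sum, geom_sum_mul_neg]

/-! ### The involution and inverse-closedness -/

theorem toOp_star (A : BeurlingAlgebra p ω) : toOp p ω (star A) = star (toOp p ω A) := by
  rw [ContinuousLinearMap.star_eq_adjoint]
  refine op_ext fun l c k => ?_
  have h : ∀ (f : L2 d) k, f k = inner ℂ (lp.single 2 k (1 : ℂ) : L2 d) f := fun f k => by
    rw [lp.inner_single_left]
    simp
  rw [h (ContinuousLinearMap.adjoint _ _), ContinuousLinearMap.adjoint_inner_right,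
    lp.inner_single_right]
  have h1 : toOp p ω (star A) (lp.single 2 l c) k = (star A).mat k l * c := op_single _ _ _ _
  have h2 : toOp p ω A (lp.single 2 k 1) l = A.mat l k * 1 := op_single _ _ _ _
  rw [h1, h2, mat_star, Matrix.conjTranspose_apply]
  simp [mul_comm]

end BeurlingAlgebra

/-! ### Normalizing `T^* T` near the identity. -/

/-- If `T` is left invertible, some positive multiple of `T^* T` is at distance less than `1` from
the identity. -/
theorem exists_norm_one_sub_smul_star_mul_self_lt_one {S T : L2 d →L[ℂ] L2 d} (h : S * T = 1) :
    ∃ t : ℝ, 0 < t ∧ ‖1 - (t : ℂ) • (star T * T)‖ < 1 := by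
  have hMN : 1 ≤ ‖S‖ * ‖T‖ := by
    rw [← norm_one (α := L2 d →L[ℂ] L2 d), ← h]
    exact norm_mul_le S T
  set M := ‖T‖ with hM
  set N := ‖S‖ with hN
  have hM0 : 0 < M := lt_of_le_of_ne (norm_nonneg T) fun h0 => by
    rw [← h0, mul_zero] at hMN
    linarith
  have hN0 : 0 < N := lt_of_le_of_ne (norm_nonneg S) fun h0 => by
    rw [← h0, zero_mul] at hMN
    linarith
  -- With `t = 1 / M ^ 2`, expanding `‖f - t T^* T f‖ ^ 2` leaves at most `‖f‖ ^ 2 - t * ‖T f‖ ^ 2`,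
  -- and `‖f‖ ≤ N * ‖T f‖` bounds this by `θ * ‖f‖ ^ 2`.
  set θ := 1 - 1 / (N * M) ^ 2 with hθ
  have hθ0 : 0 ≤ θ := sub_nonneg.2 ((div_le_one (by positivity)).2 (one_le_pow₀ hMN))
  have hθ1 : θ < 1 := by
    have : 0 < 1 / (N * M) ^ 2 := by positivity
    linarith
  refine ⟨(M ^ 2)⁻¹, by positivity, lt_of_le_of_lt ?_ ((Real.sqrt_lt' one_pos).2
    (by rwa [one_pow] : θ < 1 ^ 2))⟩
  refine ContinuousLinearMap.opNorm_le_bound _ (Real.sqrt_nonneg _) fun f => ?_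
  rw [← Real.sqrt_sq (norm_nonneg f), ← Real.sqrt_mul hθ0]
  refine Real.le_sqrt_of_sq_le ?_
  set H := star T (T f) with hH
  have hE : (1 - (((M ^ 2)⁻¹ : ℝ) : ℂ) • (star T * T)) f = f - (((M ^ 2)⁻¹ : ℝ) : ℂ) • H := rfl
  have hinner : RCLike.re (inner ℂ f ((((M ^ 2)⁻¹ : ℝ) : ℂ) • H)) = (M ^ 2)⁻¹ * ‖T f‖ ^ 2 := by
    rw [inner_smul_right, hH, ContinuousLinearMap.star_eq_adjoint,
      ContinuousLinearMap.adjoint_inner_right]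
    change (_ * inner ℂ (T f) (T f) : ℂ).re = _
    rw [Complex.re_ofReal_mul]
    congr 1
    exact inner_self_eq_norm_sq (𝕜 := ℂ) (T f)
  have hnH : ‖H‖ ≤ M * ‖T f‖ := by
    have := (star T).le_opNorm (T f)
    rwa [show ‖star T‖ = M from norm_star T] at this
  have hnf : ‖f‖ ≤ N * ‖T f‖ := by
    have h1 : S (T f) = f := by
      change (S * T) f = f
      rw [h]
      rfl
    calc ‖f‖ = ‖S (T f)‖ := by rw [h1]
      _ ≤ _ := S.le_opNorm _
  have hnt : ‖(((M ^ 2)⁻¹ : ℝ) : ℂ) • H‖ ^ 2 ≤ (M ^ 2)⁻¹ * ‖T f‖ ^ 2 := by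
    rw [norm_smul, Complex.norm_real, Real.norm_of_nonneg (by positivity), mul_pow]
    calc (M ^ 2)⁻¹ ^ 2 * ‖H‖ ^ 2 ≤ (M ^ 2)⁻¹ ^ 2 * (M * ‖T f‖) ^ 2 := by gcongr
      _ = _ := by field_simp
  have hlow : ‖f‖ ^ 2 * (1 / (N * M) ^ 2) ≤ (M ^ 2)⁻¹ * ‖T f‖ ^ 2 := by
    calc ‖f‖ ^ 2 * (1 / (N * M) ^ 2) ≤ (N * ‖T f‖) ^ 2 * (1 / (N * M) ^ 2) := by gcongr
      _ = _ := by field_simp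
  rw [hE, @norm_sub_sq ℂ, hinner, hθ]
  linarith

/-! ### Inverse-closedness, spectra and symmetry. -/

namespace BeurlingAlgebra

variable {p : Set.Ioc (0 : ℝ) 1} {ω : AdmissibleWeight d}

theorem isUnit_star_mul_self (hω : ω.WeakGrowth) {A : BeurlingAlgebra p ω}
    {S : L2 d →L[ℂ] L2 d} (hS : S * toOp p ω A = 1) : IsUnit (star A * A) := by
  obtain ⟨t, ht, h⟩ := exists_norm_one_sub_smul_star_mul_self_lt_one hS
  have h1 : ‖toOp p ω (1 - (t : ℂ) • (star A * A))‖ < 1 := by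
    rwa [map_sub, map_one, map_smul, map_mul, toOp_star]
  have h2 := isUnit_one_sub hω h1
  rw [sub_sub_cancel, Algebra.smul_def] at h2
  exact ((Commute.isUnit_mul_iff (Algebra.commutes (t : ℂ) (star A * A))).1 h2).2

/-- The matrix `(A^* A)⁻¹ A^*` is a left inverse of `A` in the algebra; its operator must coincide
with the given two-sided inverse. -/
theorem isInverseClosed (hω : ω.WeakGrowth) : IsInverseClosed (toOp p ω) := by
  refine ⟨toOp_injective, fun A S h1 h2 => ?_⟩
  obtain ⟨u, hu⟩ := isUnit_star_mul_self hω h2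
  refine ⟨↑u⁻¹ * star A, ?_⟩
  have h3 : (↑u⁻¹ * star A) * A = 1 := by rw [mul_assoc, ← hu, Units.inv_mul]
  calc toOp p ω (↑u⁻¹ * star A) = toOp p ω (↑u⁻¹ * star A) * (toOp p ω A * S) := by
        rw [h1, mul_one]
    _ = S := by rw [← mul_assoc, ← map_mul, h3, map_one, one_mul]

theorem spectrum_eq (hω : ω.WeakGrowth) (A : BeurlingAlgebra p ω) :
    spectrum ℂ A = spectrum ℂ (toOp p ω A) := by
  refine Set.Subset.antisymm (fun z hz hu => hz ?_) (AlgHom.spectrum_apply_subset _ _)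
  obtain ⟨u, hu⟩ := hu
  rw [← AlgHom.commutes (toOp p ω), ← map_sub] at hu
  have h1 : toOp p ω (algebraMap ℂ _ z - A) * ↑u⁻¹ = 1 := by rw [← hu, Units.mul_inv]
  have h2 : ↑u⁻¹ * toOp p ω (algebraMap ℂ _ z - A) = 1 := by rw [← hu, Units.inv_mul]
  obtain ⟨C, hC⟩ := (isInverseClosed hω).2 _ _ h1 h2
  refine ⟨⟨_, C, toOp_injective ?_, toOp_injective ?_⟩, rfl⟩
  · rw [map_mul, hC, h1, map_one]
  · rw [map_mul, hC, h2, map_one]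

theorem pSpectralRadius_eq (hω : ω.WeakGrowth) {A : BeurlingAlgebra p ω} (hA : IsSelfAdjoint A) :
    pSpectralRadius p A = ‖toOp p ω A‖ₑ ^ (p : ℝ) := by
  have hsa : IsSelfAdjoint (toOp p ω A) := by
    rw [IsSelfAdjoint, ← toOp_star, hA.star_eq]
  have hr : spectralRadius ℂ (toOp p ω A) = ‖toOp p ω A‖ₑ := hsa.spectralRadius_eq_nnnorm
  rw [pSpectralRadius, spectrum_eq hω, ← hr]
  refine le_antisymm (iSup₂_le fun z hz => ?_) ?_
  · exact ENNReal.rpow_le_rpow (le_iSup₂ (f := fun z (_ : z ∈ spectrum ℂ (toOp p ω A)) =>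
      (‖z‖₊ : ℝ≥0∞)) z hz) p.2.1.le
  -- The spectral radius is attained at a point of the spectrum, so the power passes through the
  -- supremum.
  · obtain ⟨z, hz, h⟩ := spectrum.exists_nnnorm_eq_spectralRadius_of_nonempty
      (spectrum.nonempty (toOp p ω A))
    rw [← h]
    exact le_iSup₂ (f := fun z (_ : z ∈ spectrum ℂ (toOp p ω A)) => ‖z‖ₑ ^ (p : ℝ)) z hz

theorem isSymmetricAlgebra (hω : ω.WeakGrowth) : IsSymmetricAlgebra (BeurlingAlgebra p ω) := by
  intro A z hz
  rw [spectrum_eq hω, map_mul, toOp_star] at hz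
  have hsa : IsSelfAdjoint (toOp p ω A * star (toOp p ω A)) := IsSelfAdjoint.mul_star_self _
  have hre := hsa.mem_spectrum_eq_re hz
  refine ⟨z.re, ?_, hre⟩
  rw [hre] at hz
  have h1 : z.re ∈ spectrum ℝ (toOp p ω A * star (toOp p ω A)) :=
    (spectrum.algebraMap_mem_iff ℂ).1 hz
  -- Positivity is available for `b^* b`; taking `b` to be the adjoint of `T_A` gives the order
  -- needed here.
  have h2 := spectrum_star_mul_self_nonneg (b := star (toOp p ω A))
  rw [star_star] at h2
  exact h2 _ h1

end BeurlingAlgebra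

end PBeurling
end

theorem theorem4p1 (d : ℕ) (p : Set.Ioc (0 : ℝ) 1) (ω : PBeurling.AdmissibleWeight d)
    (hω : ω.WeakGrowth) :
    (∀ A : PBeurling.BeurlingAlgebra p ω, IsSelfAdjoint A →
      PBeurling.pSpectralRadius p A = ‖PBeurling.BeurlingAlgebra.toOp p ω A‖ₑ ^ (p : ℝ) ∧
      spectrum ℂ A = spectrum ℂ (PBeurling.BeurlingAlgebra.toOp p ω A)) ∧
    PBeurling.IsSymmetricAlgebra (PBeurling.BeurlingAlgebra p ω) ∧
    PBeurling.IsInverseClosed (PBeurling.BeurlingAlgebra.toOp p ω) :=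
  ⟨fun _ hA => ⟨PBeurling.BeurlingAlgebra.pSpectralRadius_eq hω hA,
    PBeurling.BeurlingAlgebra.spectrum_eq hω _⟩,
    PBeurling.BeurlingAlgebra.isSymmetricAlgebra hω, PBeurling.BeurlingAlgebra.isInverseClosed hω⟩
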